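/- Let $T>0$, $A,\rho\in\mathbb R$ and $\sigma>0$, $\sigma\neq 1$. Assume $AT>1$, let $\xi$ be the (unique) strictly positive root of $z=A(1-e^{-zT})$, and assume $\rho>\xi(1-\sigma)$ and $\frac{\rho-\xi(1-\sigma)}{\sigma}<A$. Delay problem. Given $\bar\iota\in L^2(-T,0)$ and $i:[0,\infty)\to\mathbb R$, let $k$ solve $k'(t)=i(t)-i(t-T)$ for $t\ge0$, $i=\bar\iota$ on $[-T,0)$, $k(0)=\int_{-T}^0\bar\iota(s)\,ds$. Over the set of all $i\in L^2_{\rm loc}([0,\infty))$ with $i(t)\in[0,Ak(t)]$ for all $t\ge0$, maximize $$J(\bar\iota;i)=\int_0^\infty e^{-\rho t}\frac{(Ak(t)-i(t))^{1-\sigma}}{1-\sigma}\,dt\in[-\infty,+\infty].$$ Write $V$ for the supremum. Hilbert space setting. Let $X=\mathbb R\times L^2(-T,0)$, $D(\mathcal A)=\{(\psi^0,\psi^1)\in X:\psi^1\in W^{1,2}(-T,0),\ \psi^0=\psi^1(0)\}$, $\mathcal A(\psi^0,\psi^1)=(0,\tfrac{d}{ds}\psi^1)$, $B(\psi^0,\psi^1)=\psi^1(0)-\psi^1(-T)$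 on $D(\mathcal A)$, and $F(z)(s)=-z(-T-s)$ for $z\in L^2(-T,0)$. Put $$\Gamma_0(x)=x^0+\int_{-T}^0e^{\xi s}x^1(s)\,ds,\qquad \nu=\Big(\frac{\rho-\xi(1-\sigma)}{\sigma}\Big)^{-\sigma}\Big(\frac A\xi\Big)^{1-\sigma},$$ $$\phi(x)=Ax^0-\nu^{-1/\sigma}\Big(\frac A\xi\Big)^{1/\sigma}\Gamma_0(x),\qquad \mathcal O=\{x\in X:\Gamma_0(x)>0,\ \phi(x)>0\},\qquad v(x)=\nu\,\frac{\Gamma_0(x)^{1-\sigma}}{1-\sigma}\ \text{ on } \mathcal O.$$ Theorem. Let $\bar\iota\in L^2(-T,0)$ with $\bar\iota\ge0$ a.e., let $k_0=\int_{-T}^0\bar\iota(s)\,ds>0$, and let $x=(k_0,F(\bar\iota))$. Then the closed-loop equation $$y'(t)=\mathcal A^*y(t)+B^*\phi(y(t)),\qquad y(0)=x,$$ has a unique solution $y\in C([0,\infty);X)$, where the equation is understood in $D(\mathcal A)'$, i.e. $\langle y(t),\psi\rangle=\langle x,\psi\rangle+\int_0^t\big(\langle y(s),\mathcal A\psi\rangle+\phi(y(s))\,B\psi\big)ds$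 for all $\psi\in D(\mathcal A)$ and $t\ge0$. For all $t\ge0$ one has $y(t)\in\mathcal O$, $y^0(t)>0$ and $\phi(y(t))>0$. The control $i^*(t)=\phi(y(t))$ is admissible and optimal for the delay problem with datum $\bar\iota$, and the value of that problem is $V=v(x)$. -/

import Mathlib

open MeasureTheory Set
open scoped ENNReal

namespace VintageCapital

noncomputable section

/-- Lebesgue measure on the history interval `(-T, 0)`. -/
abbrev histMeasure (T : ℝ) : Measure ℝ := volume.restrict (Ioo (-T) 0)

/-- The space `L²(-T, 0; ℝ)`. -/
abbrev L2Hist (T : ℝ) : Type := Lp ℝ 2 (histMeasure T)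

/-- The Hilbert space `X = ℝ × L²(-T, 0; ℝ)` with the product inner product. -/
abbrev StateSpace (T : ℝ) : Type := WithLp 2 (ℝ × L2Hist T)

theorem measurePreserving_reflect (T : ℝ) :
    MeasurePreserving (fun s : ℝ => -T - s) (histMeasure T) (histMeasure T) := by
  have h : MeasurePreserving (fun s : ℝ => -T - s) volume volume :=
    Measure.measurePreserving_sub_left volume (-T)
  have h2 := h.restrict_preimage (s := Ioo (-T) 0) measurableSet_Ioo
  have h3 : (fun s : ℝ => -T - s) ⁻¹' (Ioo (-T) 0) = Ioo (-T) 0 := by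
    ext s
    simp only [mem_preimage, mem_Ioo]
    constructor <;> rintro ⟨h1, h2⟩ <;> constructor <;> linarith
  rwa [h3] at h2

/-- The operator `F` on `L²(-T, 0)`, `F(z)(s) = -z(-T - s)`. -/
def histF (T : ℝ) (z : L2Hist T) : L2Hist T :=
  -(Lp.compMeasurePreserving (fun s : ℝ => -T - s) (measurePreserving_reflect T) z)

/-- An element of the domain `D(𝒜) = {(ψ⁰, ψ¹) ∈ X : ψ¹ ∈ W^{1,2}(-T, 0), ψ⁰ = ψ¹(0)}`, given
together with the absolutely continuous representative `rep` of `ψ¹` on `[-T, 0]` and its weak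
derivative `der ∈ L²(-T, 0)`. -/
structure DomA (T : ℝ) where
  /-- the pair `(ψ⁰, ψ¹)` -/
  val : StateSpace T
  /-- the representative of `ψ¹` (only its values on `[-T, 0]` matter) -/
  rep : ℝ → ℝ
  /-- the derivative of `ψ¹` -/
  der : L2Hist T
  snd_ae_eq : (val.snd : ℝ → ℝ) =ᵐ[histMeasure T] rep
  rep_eq : ∀ s ∈ Icc (-T) 0, rep s = rep 0 - ∫ r in s..0, der r
  fst_eq : val.fst = rep 0

/-- The operator `𝒜(ψ⁰, ψ¹) = (0, dψ¹/ds)` on `D(𝒜)`. -/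
def DomA.opA {T : ℝ} (ψ : DomA T) : StateSpace T := WithLp.toLp 2 (0, ψ.der)

/-- The operator `B(ψ⁰, ψ¹) = ψ¹(0) - ψ¹(-T)` on `D(𝒜)`. -/
def DomA.opB {T : ℝ} (ψ : DomA T) : ℝ := ψ.rep 0 - ψ.rep (-T)

/-- The adjoint `𝒜^* : X → D(𝒜)'`, as a functional on `D(𝒜)`. -/
def adjA {T : ℝ} (x : StateSpace T) (ψ : DomA T) : ℝ := inner ℝ x ψ.opA

/-- The adjoint `B^* : ℝ → D(𝒜)'`, as a functional on `D(𝒜)`. -/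
def adjB {T : ℝ} (u : ℝ) (ψ : DomA T) : ℝ := u * ψ.opB

/-- `y ∈ C([0,∞); X)` solves the closed-loop equation `y' = 𝒜^* y + B^* φ(y)`, `y(0) = x`, with
values in `D(𝒜)'`: the equation is tested against every `ψ ∈ D(𝒜)` and integrated in time. -/
def IsClosedLoopSolution {T : ℝ} (φ : StateSpace T → ℝ) (x : StateSpace T)
    (y : ℝ → StateSpace T) : Prop :=
  ContinuousOn y (Ici 0) ∧ y 0 = x ∧
    ∀ ψ : DomA T, ∀ t : ℝ, 0 ≤ t →
      inner ℝ (y t) ψ.val = inner ℝ x ψ.val + ∫ s in (0 : ℝ)..t, (adjA (y s) ψ + adjB (φ (y s)) ψ)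

/-- The equivalent capital `Γ₀(x) = x⁰ + ∫_{-T}^0 e^{ξ s} x¹(s) ds`. -/
def Gamma0 {T : ℝ} (ξ : ℝ) (x : StateSpace T) : ℝ :=
  x.fst + ∫ s in Ioo (-T) 0, Real.exp (ξ * s) * x.snd s

/-- The constant `ν = ((ρ - ξ(1-σ))/σ)^{-σ} (A/ξ)^{1-σ}`. -/
def nu (A σ ρ ξ : ℝ) : ℝ :=
  ((ρ - ξ * (1 - σ)) / σ) ^ (-σ) * (A / ξ) ^ (1 - σ)

/-- The set `𝒪`. -/
def setO (T A σ ρ ξ : ℝ) : Set (StateSpace T) :=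
  {x | 0 < Gamma0 ξ x ∧
    nu A σ ρ ξ ^ (-1 / σ) * (A / ξ) ^ (1 / σ) * Gamma0 ξ x < A * x.fst}

/-- The feedback map `φ(x) = i^*(x) = A x⁰ - ν^{-1/σ} (A/ξ)^{1/σ} Γ₀(x)`
(the formula makes sense on all of `X`). -/
def feedback {T : ℝ} (A σ ρ ξ : ℝ) (x : StateSpace T) : ℝ :=
  A * x.fst - nu A σ ρ ξ ^ (-1 / σ) * (A / ξ) ^ (1 / σ) * Gamma0 ξ x

/-- The function `v(x) = ν Γ₀(x)^{1-σ} / (1-σ)`. -/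
def candidateV {T : ℝ} (A σ ρ ξ : ℝ) (x : StateSpace T) : ℝ :=
  nu A σ ρ ξ * (Gamma0 ξ x ^ (1 - σ) / (1 - σ))

/-- The investment path on `[-T, ∞)`: the datum `ι` before time `0`, the control `i` afterwards. -/
def investment {T : ℝ} (ι : L2Hist T) (i : ℝ → ℝ) (s : ℝ) : ℝ := if s < 0 then ι s else i s

/-- The capital stock: the (Carathéodory) solution of `k'(t) = i(t) - i(t - T)`,
`k(0) = ∫_{-T}^0 ι`, with `i = ι` on `[-T, 0)`. -/
def capital {T : ℝ} (ι : L2Hist T) (i : ℝ → ℝ) (t : ℝ) : ℝ :=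
  (∫ s in Ioo (-T) 0, ι s) +
    ∫ s in (0 : ℝ)..t, (investment ι i s - investment ι i (s - T))

/-- The admissible controls: `i ∈ L²_loc([0, ∞))` with `i(t) ∈ [0, A k(t)]` for all `t ≥ 0`. -/
def admissible {T : ℝ} (A : ℝ) (ι : L2Hist T) : Set (ℝ → ℝ) :=
  {i | (∀ R : ℝ, MemLp i 2 (volume.restrict (Icc 0 R))) ∧
    ∀ t : ℝ, 0 ≤ t → i t ∈ Icc 0 (A * capital ι i t)}

/-- The functional `J(ι; i) = ∫_0^∞ e^{-ρ t} (A k(t) - i(t))^{1-σ} / (1-σ) dt` as an extended real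
number. The integrand has a constant sign on admissible controls; for `σ > 1` its value at zero
consumption is `-∞`, as the convention `0 ^ (1-σ) = ∞` in `[0, ∞]` provides. -/
def welfare {T : ℝ} (A σ ρ : ℝ) (ι : L2Hist T) (i : ℝ → ℝ) : EReal :=
  (((1 - σ)⁻¹ : ℝ) : EReal) *
    ((∫⁻ t in Ioi (0 : ℝ), ENNReal.ofReal (Real.exp (-ρ * t)) *
      ENNReal.ofReal (A * capital ι i t - i t) ^ (1 - σ) : ℝ≥0∞) : EReal)

/-- The value function of the delay problem. -/
def value {T : ℝ} (A σ ρ : ℝ) (ι : L2Hist T) : EReal :=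
  ⨆ i ∈ admissible A ι, welfare A σ ρ ι i

/-- Optimality of a control for the delay problem. -/
def IsOptimal {T : ℝ} (A σ ρ : ℝ) (ι : L2Hist T) (i : ℝ → ℝ) : Prop :=
  i ∈ admissible A ι ∧ ∀ j ∈ admissible A ι, welfare A σ ρ ι j ≤ welfare A σ ρ ι i

end

end VintageCapital

namespace VintageCapital

/-! The proof replaces dynamic programming by a budget constraint. `Gamma0 ξ` is the pairing with
the element of `DomA` represented by `exp (ξ s)`, and the equation for `ξ` makes `opB` of that
element equal to `ξ / A`. Hence, along any control with consumption `c = A k - i`, one has `Γ₀' = ξ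
Γ₀ - (ξ / A) c` (`IsStatePath.exp_mul_Gamma0`). Nonnegative past investment forces `Γ₀ ≥ 0`
(`Gamma0_bounds`), so every admissible consumption satisfies `∫ exp (-ξ t) c ≤ (A / ξ) Γ₀(x)`.

Put `θ = (ρ - ξ (1 - σ)) / σ`. On `c* = C exp ((ξ - θ) t)` with `C = θ (A / ξ) Γ₀(x)`, discounted
marginal utility is a multiple of the price `exp (-ξ t)`, and `c*` exhausts the budget. The tangent
line inequality for the power at `c*`, integrated in time, shows that no admissible consumption does
better. The utility of `c*` is `v(x)`.

The feedback satisfies `A x⁰ - φ(x) = θ (A / ξ) Γ₀(x)`, so the closed loop gives `Γ₀' = (ξ - θ) Γ₀`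
and consumption `c*`. A control producing `c*` comes from a Volterra equation
(`exists_control_of_consumption`), and its states solve the weak equation (`IsStatePath.inner_eq`).
The control is positive: at a first time with `i ≤ 0`, the bound `Γ₀ ≤ (ξ / A) k` would give `i ≥ (A
- θ) k > 0`.

For uniqueness, `Γ₀` of a difference `w` of solutions obeys a homogeneous linear equation and
vanishes, so the input reduces to `A w⁰`. Testing with translates then yields a Gronwall inequality
for `∫ w⁰`, and afterwards the vanishing of the history component (`SolvesFromZero.eq_zero`). -/

/-! ### Calculus preliminaries. -/

/-- Variation of constants for an absolutely continuous solution of `G' = κ G - c`. -/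
theorem exp_neg_mul_eq_of_integral_eq {G c : ℝ → ℝ} {κ G₀ R : ℝ} (hR : 0 ≤ R)
    (hG : IntervalIntegrable G volume 0 R) (hc : IntervalIntegrable c volume 0 R)
    (h : ∀ t ∈ Icc 0 R, G t = G₀ + ∫ s in (0 : ℝ)..t, (κ * G s - c s)) :
    Real.exp (-κ * R) * G R = G₀ - ∫ s in (0 : ℝ)..R, Real.exp (-κ * s) * c s := by
  have hh : IntervalIntegrable (fun s => κ * G s - c s) volume 0 R := (hG.const_mul κ).sub hc
  have hder : ∀ s : ℝ, HasDerivAt (fun s => Real.exp (-κ * s)) (-κ * Real.exp (-κ * s)) s := by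
    intro s
    have := ((hasDerivAt_id s).const_mul (-κ)).exp
    simpa [mul_comm] using this
  have hcont : Continuous (fun s => Real.exp (-κ * s)) := by fun_prop
  -- Since `c` is only integrable, the integration by parts is the absolutely continuous one, with
  -- derivatives of the primitive taken almost everywhere.
  have hf : AbsolutelyContinuousOnInterval (fun s => Real.exp (-κ * s)) 0 R := by
    apply ContDiffOn.absolutelyContinuousOnInterval
    exact ContDiff.contDiffOn (by fun_prop)
  have hg := hh.absolutelyContinuousOnInterval_intervalIntegral (c := 0) left_mem_uIcc
  have key := hf.integral_mul_deriv_eq_deriv_mul hg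
  have e1 : ∫ s in (0 : ℝ)..R, Real.exp (-κ * s) *
      deriv (fun x => ∫ v in (0 : ℝ)..x, (κ * G v - c v)) s =
      ∫ s in (0 : ℝ)..R, Real.exp (-κ * s) * (κ * G s - c s) := by
    apply intervalIntegral.integral_congr_ae
    filter_upwards [hh.ae_hasDerivAt_integral] with s hs hs'
    rw [(hs (uIoc_subset_uIcc hs') 0 left_mem_uIcc).deriv]
  have e2 : ∫ s in (0 : ℝ)..R, deriv (fun s => Real.exp (-κ * s)) s *
      (∫ v in (0 : ℝ)..s, (κ * G v - c v)) =
      ∫ s in (0 : ℝ)..R, (-κ * Real.exp (-κ * s) * G s - (-κ * Real.exp (-κ * s)) * G₀) := by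
    apply intervalIntegral.integral_congr
    intro s hs
    rw [uIcc_of_le hR] at hs
    have := h s hs
    simp only [(hder s).deriv]
    rw [show (∫ v in (0 : ℝ)..s, (κ * G v - c v)) = G s - G₀ by linarith]
    ring
  have e3 : ∫ s in (0 : ℝ)..R, -κ * Real.exp (-κ * s) = Real.exp (-κ * R) - 1 := by
    rw [intervalIntegral.integral_eq_sub_of_hasDerivAt (fun s _ => hder s)
      (by apply Continuous.intervalIntegrable; fun_prop)]
    simp
  have i1 : IntervalIntegrable (fun s => -κ * Real.exp (-κ * s) * G s) volume 0 R :=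
    hG.continuousOn_mul (Continuous.continuousOn (by fun_prop))
  have i2 : IntervalIntegrable (fun s => -κ * Real.exp (-κ * s)) volume 0 R :=
    Continuous.intervalIntegrable (by fun_prop) _ _
  have i3 : IntervalIntegrable (fun s => Real.exp (-κ * s) * c s) volume 0 R :=
    hc.continuousOn_mul hcont.continuousOn
  rw [e1, e2, intervalIntegral.integral_sub i1 (i2.mul_const _),
    intervalIntegral.integral_mul_const, e3] at key
  have e4 : ∫ s in (0 : ℝ)..R, Real.exp (-κ * s) * (κ * G s - c s) =
      -(∫ s in (0 : ℝ)..R, -κ * Real.exp (-κ * s) * G s) -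
        ∫ s in (0 : ℝ)..R, Real.exp (-κ * s) * c s := by
    have i1n : IntervalIntegrable (fun s => -(-κ * Real.exp (-κ * s) * G s)) volume 0 R := i1.neg
    rw [← intervalIntegral.integral_neg, ← intervalIntegral.integral_sub i1n i3]
    congr 1
    ext s
    ring
  have e5 := h R (right_mem_Icc.2 hR)
  rw [e4, show (∫ v in (0 : ℝ)..R, (κ * G v - c v)) = G R - G₀ by linarith,
    intervalIntegral.integral_same] at key
  linarith

/-- Tangent line inequality for the concave power. -/
theorem rpow_add_le_of_lt_one {σ c c₀ : ℝ} (hσ0 : 0 < σ) (hσ : σ < 1) (hc : 0 ≤ c) (hc₀ : 0 < c₀) :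
    c ^ (1 - σ) + (1 - σ) * (c₀ ^ (-σ) * c₀) ≤ c₀ ^ (1 - σ) + (1 - σ) * (c₀ ^ (-σ) * c) := by
  -- Bernoulli's inequality for the ratio `c / c₀`, to be scaled by `c₀ ^ (1 - σ)`.
  have h := rpow_one_add_le_one_add_mul_self (s := c / c₀ - 1)
    (by have := div_nonneg hc hc₀.le; linarith) (p := 1 - σ) (by linarith) (by linarith)
  have e : c₀ ^ (1 - σ) = c₀ ^ (-σ) * c₀ := by
    rw [← Real.rpow_add_one hc₀.ne']; ring_nf
  rw [add_sub_cancel, Real.div_rpow hc hc₀.le, div_le_iff₀ (Real.rpow_pos_of_pos hc₀ _)] at h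
  have e2 : (1 + (1 - σ) * (c / c₀ - 1)) * c₀ ^ (1 - σ) =
      c₀ ^ (1 - σ) + (1 - σ) * (c₀ ^ (-σ) * c) - (1 - σ) * (c₀ ^ (-σ) * c₀) := by
    rw [e]; field_simp; ring
  linarith

/-- Tangent line inequality for the convex power. -/
theorem rpow_add_le_of_one_lt {σ c c₀ : ℝ} (hσ : 1 < σ) (hc : 0 < c) (hc₀ : 0 < c₀) :
    c₀ ^ (1 - σ) + (σ - 1) * (c₀ ^ (-σ) * c₀) ≤ c ^ (1 - σ) + (σ - 1) * (c₀ ^ (-σ) * c) := by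
  have hq : 0 < c / c₀ := div_pos hc hc₀
  have h : 1 + (1 - σ) * (c / c₀ - 1) ≤ (c / c₀) ^ (1 - σ) := by
    rw [Real.rpow_def_of_pos hq]
    have h1 := Real.add_one_le_exp (Real.log (c / c₀) * (1 - σ))
    have h2 := Real.log_le_sub_one_of_pos hq
    nlinarith
  have e : c₀ ^ (1 - σ) = c₀ ^ (-σ) * c₀ := by
    rw [← Real.rpow_add_one hc₀.ne']; ring_nf
  rw [Real.div_rpow hc.le hc₀.le, le_div_iff₀ (Real.rpow_pos_of_pos hc₀ _)] at h
  have e2 : (1 + (1 - σ) * (c / c₀ - 1)) * c₀ ^ (1 - σ) =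
      c₀ ^ (1 - σ) + (1 - σ) * (c₀ ^ (-σ) * c) - (1 - σ) * (c₀ ^ (-σ) * c₀) := by
    rw [e]; field_simp; ring
  linarith

/-- The linear functionals on the state space behind the weak formulation. -/
theorem inner_state_eq {T : ℝ} (x y : StateSpace T) :
    inner ℝ x y = x.fst * y.fst + ∫ s in Ioo (-T) 0, x.snd s * y.snd s := by
  rw [WithLp.prod_inner_apply, L2.inner_def]
  congr 1
  · simp [mul_comm]
  · congr 1; ext s; simp [mul_comm]

/-- The product rule for primitives of integrable functions. -/
theorem integral_primitive_mul_add {f g : ℝ → ℝ} {a b : ℝ}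
    (hf : IntervalIntegrable f volume a b) (hg : IntervalIntegrable g volume a b) :
    ∫ x in a..b, (f x * (∫ r in a..x, g r) + (∫ r in a..x, f r) * g x) =
      (∫ x in a..b, f x) * ∫ x in a..b, g x := by
  have hF := hf.absolutelyContinuousOnInterval_intervalIntegral (c := a) left_mem_uIcc
  have hG := hg.absolutelyContinuousOnInterval_intervalIntegral (c := a) left_mem_uIcc
  have key := hF.integral_deriv_mul_eq_sub hG
  rw [intervalIntegral.integral_same, intervalIntegral.integral_same, mul_zero, sub_zero] at key
  rw [← key]
  apply intervalIntegral.integral_congr_ae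
  filter_upwards [hf.ae_hasDerivAt_integral, hg.ae_hasDerivAt_integral] with s hs1 hs2 hs'
  rw [(hs1 (uIoc_subset_uIcc hs') a left_mem_uIcc).deriv,
    (hs2 (uIoc_subset_uIcc hs') a left_mem_uIcc).deriv]

theorem setIntegral_Ioo_eq {T : ℝ} (hT : 0 < T) (f : ℝ → ℝ) :
    ∫ s in Ioo (-T) 0, f s = ∫ s in (-T)..0, f s := by
  rw [intervalIntegral.integral_of_le (by linarith), integral_Ioc_eq_integral_Ioo]

theorem L2Hist.intervalIntegrable {T : ℝ} (hT : 0 < T) (f : L2Hist T) :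
    IntervalIntegrable f volume (-T) 0 := by
  rw [intervalIntegrable_iff_integrableOn_Ioo_of_le (by linarith)]
  exact (Lp.memLp f).integrable (by norm_num)

/-! ### Continuous state paths generated by a control. -/

/-- A truncation of the investment path which is globally square integrable. -/
noncomputable def truncatedInvestment {T : ℝ} (ι : L2Hist T) (j : ℝ → ℝ) (R : ℝ) : ℝ → ℝ :=
  (Ioo (-T) 0).indicator ι + (Icc 0 R).indicator j

section Truncated

variable {T : ℝ} {ι : L2Hist T} {j : ℝ → ℝ} {R : ℝ}

theorem truncatedInvestment_eq {s : ℝ} (hs : s ∈ Ioc (-T) R) :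
    truncatedInvestment ι j R s = investment ι j s := by
  unfold truncatedInvestment investment
  rcases lt_or_ge s 0 with h | h
  · have h1 : s ∈ Ioo (-T) 0 := ⟨hs.1, h⟩
    have h2 : s ∉ Icc 0 R := fun h' => absurd h'.1 (not_le.2 h)
    simp [h1, h2, h]
  · have h1 : s ∉ Ioo (-T) 0 := fun h' => absurd h'.2 (not_lt.2 h)
    have h2 : s ∈ Icc 0 R := ⟨h, hs.2⟩
    simp [h1, h2, not_lt.2 h]

theorem memLp_truncatedInvestment (hj : ∀ R : ℝ, MemLp j 2 (volume.restrict (Icc 0 R))) :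
    MemLp (truncatedInvestment ι j R) 2 volume :=
  ((memLp_indicator_iff_restrict measurableSet_Ioo).2 (Lp.memLp ι)).add
    ((memLp_indicator_iff_restrict measurableSet_Icc).2 (hj R))

theorem integrable_truncatedInvestment (hj : ∀ R : ℝ, MemLp j 2 (volume.restrict (Icc 0 R))) :
    Integrable (truncatedInvestment ι j R) volume := by
  apply Integrable.add
  · rw [integrable_indicator_iff measurableSet_Ioo]
    exact (Lp.memLp ι).integrable (by norm_num)
  · rw [integrable_indicator_iff measurableSet_Icc]
    exact (hj R).integrable (by norm_num)

/-- The initial value `k(0) = ∫ ι` is exactly the one for which integrating `k'` leaves a sliding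
window of investment. -/
theorem capital_eq_truncated (hT : 0 < T)
    (hj : ∀ R : ℝ, MemLp j 2 (volume.restrict (Icc 0 R))) {t : ℝ} (ht : t ∈ Icc 0 R) :
    capital ι j t = ∫ s in (t - T)..t, truncatedInvestment ι j R s := by
  have hE := integrable_truncatedInvestment (ι := ι) (R := R) hj
  have hI : ∀ a b : ℝ, IntervalIntegrable (truncatedInvestment ι j R) volume a b :=
    fun a b => hE.intervalIntegrable
  have h1 : ∫ s in Ioo (-T) 0, ι s = ∫ s in (-T)..0, truncatedInvestment ι j R s := by
    rw [← setIntegral_Ioo_eq hT]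
    refine setIntegral_congr_fun measurableSet_Ioo fun s hs => ?_
    rw [truncatedInvestment_eq ⟨hs.1, by linarith [hs.2, ht.1, ht.2]⟩]
    simp [investment, hs.2]
  have h2 : ∫ s in (0 : ℝ)..t, (investment ι j s - investment ι j (s - T)) =
      ∫ s in (0 : ℝ)..t, (truncatedInvestment ι j R s - truncatedInvestment ι j R (s - T)) := by
    rw [intervalIntegral.integral_of_le ht.1, intervalIntegral.integral_of_le ht.1]
    refine setIntegral_congr_fun measurableSet_Ioc fun s hs => ?_
    rw [truncatedInvestment_eq ⟨by linarith [hs.1], by linarith [hs.2, ht.2]⟩,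
      truncatedInvestment_eq ⟨by linarith [hs.1], by linarith [hs.2, ht.2]⟩]
  have hI' : IntervalIntegrable (fun s => truncatedInvestment ι j R (s - T)) volume 0 t :=
    (hE.comp_sub_right T).intervalIntegrable
  rw [capital, h1, h2, intervalIntegral.integral_sub (hI _ _) hI',
    intervalIntegral.integral_comp_sub_right, zero_sub]
  have e1 := intervalIntegral.integral_add_adjacent_intervals (hI (-T) 0) (hI 0 t)
  have e2 := intervalIntegral.integral_add_adjacent_intervals (hI (-T) (t - T)) (hI (t - T) t)
  linarith

theorem continuous_window_integral {E : ℝ → ℝ} (hE : Integrable E volume) (T : ℝ) :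
    Continuous fun t => ∫ s in (t - T)..t, E s := by
  have hI : ∀ a b : ℝ, IntervalIntegrable E volume a b := fun a b => hE.intervalIntegrable
  have h : ∀ t, ∫ s in (t - T)..t, E s =
      (∫ s in (0 : ℝ)..t, E s) - ∫ s in (0 : ℝ)..(t - T), E s := fun t => by
    rw [intervalIntegral.integral_interval_sub_left (hI _ _) (hI _ _)]
  simp_rw [h]
  have hc := intervalIntegral.continuous_primitive hI 0
  exact hc.sub (hc.comp (continuous_id.sub continuous_const))

/-- A path on `[0, ∞)` of the states `(k(t), F(i_t))` generated by a control. -/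
def IsStatePath (ι : L2Hist T) (j : ℝ → ℝ) (y : ℝ → StateSpace T) : Prop :=
  ∀ t, 0 ≤ t → (y t).fst = capital ι j t ∧
    (y t).snd =ᵐ[histMeasure T] fun s => -investment ι j (t - T - s)

/-- The history component is the restriction to `(-T, 0)` of a translate of one fixed function in
`L²(ℝ)`; its continuity is that of translations in `L²(ℝ)`. -/
theorem exists_continuous_state_of_le (hT : 0 < T)
    (hj : ∀ R : ℝ, MemLp j 2 (volume.restrict (Icc 0 R))) (R : ℝ) :
    ∃ y : ℝ → StateSpace T, Continuous y ∧ ∀ t ∈ Icc 0 R, (y t).fst = capital ι j t ∧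
      (y t).snd =ᵐ[histMeasure T] fun s => -investment ι j (t - T - s) := by
  have hE := integrable_truncatedInvestment (ι := ι) (R := R) hj
  have hm := (memLp_truncatedInvestment (ι := ι) (R := R) hj).neg
  have hm' := hm.comp_measurePreserving (Measure.measurePreserving_sub_left volume (-T))
  have : Fact ((2 : ℝ≥0∞) ≠ ∞) := ⟨by norm_num⟩
  let e : Lp ℝ 2 (volume : Measure ℝ) := hm'.toLp _
  let tr : ℝ → Lp ℝ 2 (volume : Measure ℝ) := fun t => DomAddAct.mk (-t) +ᵥ e
  have htr : Continuous tr := by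
    have : Continuous fun t : ℝ => DomAddAct.mk (-t) :=
      DomAddAct.continuous_mk.comp continuous_neg
    exact this.vadd continuous_const
  refine ⟨fun t => WithLp.toLp 2 (∫ s in (t - T)..t, truncatedInvestment ι j R s,
    LpToLpRestrictCLM ℝ ℝ ℝ volume 2 (Ioo (-T) 0) (tr t)), ?_, ?_⟩
  · exact (WithLp.prod_continuous_toLp 2 _ _).comp ((continuous_window_integral hE T).prodMk
      ((LpToLpRestrictCLM ℝ ℝ ℝ volume 2 (Ioo (-T) 0)).continuous.comp htr))
  · intro t ht
    refine ⟨(capital_eq_truncated hT hj ht).symm, ?_⟩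
    have h1 := LpToLpRestrictCLM_coeFn ℝ (Ioo (-T) 0) (tr t)
    have h2 : tr t =ᵐ[volume] fun s => -truncatedInvestment ι j R (-T - (-t + s)) := by
      change ((DomAddAct.mk (-t) +ᵥ (hm'.toLp _) : Lp ℝ 2 (volume : Measure ℝ)) : ℝ → ℝ) =ᵐ[_] _
      rw [DomAddAct.mk_vadd_toLp]
      exact MemLp.coeFn_toLp _
    have h3 : ∀ᵐ s ∂histMeasure T, s ∈ Ioo (-T) 0 := ae_restrict_mem measurableSet_Ioo
    refine h1.trans ?_
    filter_upwards [ae_restrict_of_ae h2, h3] with s hs hs'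
    rw [hs, truncatedInvestment_eq ⟨by linarith [hs'.2, ht.1], by linarith [hs'.1, ht.2]⟩]
    congr 2
    ring

/-- The diagonal `Y t t` of the paths on `[0, R]` works: a state is determined by its capital and
its history class, so near `t` the diagonal coincides with the continuous path `Y (t + 1)`. -/
theorem exists_isStatePath (hT : 0 < T)
    (hj : ∀ R : ℝ, MemLp j 2 (volume.restrict (Icc 0 R))) :
    ∃ y : ℝ → StateSpace T, ContinuousOn y (Ici 0) ∧ IsStatePath ι j y := by
  choose Y hYc hY using fun R => exists_continuous_state_of_le (ι := ι) hT hj R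
  have hst : IsStatePath ι j fun t => Y t t := fun t ht => hY t t ⟨ht, le_rfl⟩
  refine ⟨fun t => Y t t, ?_, hst⟩
  have heq : ∀ R t, t ∈ Icc 0 R → Y t t = Y R t := by
    intro R t ht
    obtain ⟨a1, a2⟩ := hst t ht.1
    obtain ⟨b1, b2⟩ := hY R t ht
    apply (WithLp.ofLp_injective 2)
    exact Prod.ext (a1.trans b1.symm) (Lp.ext (a2.trans b2.symm))
  intro t ht
  have h1 : ContinuousWithinAt (Y (t + 1)) (Ici 0) t := (hYc (t + 1)).continuousWithinAt
  refine h1.congr_of_eventuallyEq ?_ (heq _ _ ⟨ht, by linarith⟩)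
  filter_upwards [self_mem_nhdsWithin, mem_nhdsWithin_of_mem_nhds (Iio_mem_nhds (lt_add_one t))]
    with s hs hs'
  exact heq _ _ ⟨hs, le_of_lt hs'⟩

end Truncated

/-! ### The weak state equation. -/

theorem DomA.intervalIntegral_der {T : ℝ} (hT : 0 < T) (ψ : DomA T) :
    ψ.opB = ∫ r in (-T)..0, ψ.der r := by
  have := ψ.rep_eq (-T) ⟨le_rfl, by linarith⟩
  rw [DomA.opB]; linarith

/-- Pairing of a delayed window with an element of the domain. -/
theorem window_pairing {T : ℝ} (hT : 0 < T) (ψ : DomA T) {E : ℝ → ℝ} (hE : Integrable E volume)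
    (t : ℝ) :
    (∫ s in (t - T)..t, E s) * ψ.rep 0 - ∫ s in (-T)..0, E (t - T - s) * ψ.rep s =
      ∫ r in (-T)..0, ψ.der r * ∫ s in (t - T - r)..t, E s := by
  have hEi : ∀ a b : ℝ, IntervalIntegrable (fun s => E (t - T - s)) volume a b :=
    fun a b => (hE.comp_sub_left (t - T)).intervalIntegrable
  have hD := ψ.der.intervalIntegrable hT
  have hD' : ∀ x ∈ Icc (-T) 0, IntervalIntegrable ψ.der volume (-T) x := fun x hx =>
    hD.mono_set (by rw [uIcc_of_le hx.1, uIcc_of_le (by linarith)]; exact Icc_subset_Icc_right hx.2)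
  have hD'' : ∀ x ∈ Icc (-T) 0, IntervalIntegrable ψ.der volume x 0 := fun x hx =>
    hD.mono_set (by rw [uIcc_of_le hx.2, uIcc_of_le (by linarith)]; exact Icc_subset_Icc_left hx.1)
  -- Integration by parts of `ψ.der` against `r ↦ E (t - T - r)`; the primitive of the latter from
  -- `-T` to `x` is the integral of `E` over `[t - T - x, t]`.
  have key := integral_primitive_mul_add hD (hEi (-T) 0)
  have hprim : ∀ x, ∫ r in (-T)..x, E (t - T - r) = ∫ s in (t - T - x)..t, E s := by
    intro x
    rw [intervalIntegral.integral_comp_sub_left]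
    congr 1
    ring
  have hrep : ∀ x ∈ Icc (-T) 0, ∫ r in (-T)..x, ψ.der r = ψ.rep x - ψ.rep (-T) := by
    intro x hx
    have h1 := ψ.rep_eq x hx
    have h2 := ψ.rep_eq (-T) ⟨le_rfl, by linarith⟩
    have h3 := intervalIntegral.integral_add_adjacent_intervals (hD' x hx) (hD'' x hx)
    linarith
  have hcP : ContinuousOn (fun x => ∫ r in (-T)..x, E (t - T - r)) (uIcc (-T) 0) :=
    (intervalIntegral.continuous_primitive (fun a b => hEi a b) (-T)).continuousOn
  have hcD : ContinuousOn (fun x => ∫ r in (-T)..x, ψ.der r) (uIcc (-T) 0) :=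
    intervalIntegral.continuousOn_primitive_interval' hD left_mem_uIcc
  rw [intervalIntegral.integral_add (hD.mul_continuousOn hcP) ((hEi _ _).continuousOn_mul hcD),
    hrep 0 ⟨by linarith, le_rfl⟩] at key
  simp_rw [hprim] at key
  have e1 : ∫ x in (-T)..0, (∫ r in (-T)..x, ψ.der r) * E (t - T - x) =
      (∫ s in (-T)..0, E (t - T - s) * ψ.rep s) - ψ.rep (-T) * ∫ s in (t - T)..t, E s := by
    have h0 := hprim 0
    rw [sub_zero] at h0
    rw [← h0, ← intervalIntegral.integral_const_mul, ← intervalIntegral.integral_sub]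
    · apply intervalIntegral.integral_congr
      intro x hx
      rw [uIcc_of_le (by linarith)] at hx
      simp only [hrep x hx]
      ring
    · refine (hEi _ _).mul_continuousOn ?_
      have : EqOn (fun x => (∫ r in (-T)..x, ψ.der r) + ψ.rep (-T)) ψ.rep (uIcc (-T) 0) := by
        intro x hx
        rw [uIcc_of_le (by linarith)] at hx
        simp only [hrep x hx]
        ring
      exact (hcD.add continuousOn_const).congr this.symm
    · exact (hEi _ _).const_mul _
  rw [e1, sub_zero] at key
  linarith

/-- Fubini: the integrand is a convolution integrand of two integrable functions, hence jointly
integrable. -/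
theorem integral_window_pairing {T : ℝ} (hT : 0 < T) {D : ℝ → ℝ}
    (hD : IntervalIntegrable D volume (-T) 0) {E : ℝ → ℝ} (hE : Integrable E volume) (t : ℝ) :
    ∫ τ in (0 : ℝ)..t, ∫ s in (-T)..0, E (τ - T - s) * D s =
      ∫ s in (-T)..0, D s * ∫ r in (-T - s)..(t - T - s), E r := by
  have hD1 : Integrable ((Ioc (-T) 0).indicator D) volume := by
    rw [integrable_indicator_iff measurableSet_Ioc]
    exact hD.1
  have hint : Integrable (fun p : ℝ × ℝ => (Ioc (-T) 0).indicator D p.2 * E (p.1 - p.2 - T))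
      (volume.prod volume) := by
    have := hD1.convolution_integrand (ContinuousLinearMap.mul ℝ ℝ) (hE.comp_sub_right T)
    simpa using this
  have h0 : (-T) ≤ 0 := by linarith
  have hl : ∀ τ, ∫ s in (-T)..0, E (τ - T - s) * D s =
      ∫ s, (Ioc (-T) 0).indicator D s * E (τ - s - T) := by
    intro τ
    rw [intervalIntegral.integral_of_le h0, ← integral_indicator measurableSet_Ioc]
    congr 1
    ext s
    by_cases hs : s ∈ Ioc (-T) 0
    · simp only [hs, indicator_of_mem]
      rw [mul_comm, sub_right_comm]
    · simp [hs]
  simp_rw [hl]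
  rw [intervalIntegral_integral_swap]
  · rw [intervalIntegral.integral_of_le h0, ← integral_indicator measurableSet_Ioc]
    congr 1
    ext s
    rw [intervalIntegral.integral_const_mul]
    by_cases hs : s ∈ Ioc (-T) 0
    · simp only [hs, indicator_of_mem]
      congr 1
      simp_rw [sub_sub]
      rw [intervalIntegral.integral_comp_sub_right]
      congr 1 <;> ring
    · simp [hs]
  · exact hint.mono_measure (Measure.prod_mono Measure.restrict_le_self le_rfl)

theorem DomA.inner_val {T : ℝ} (x : StateSpace T) (ψ : DomA T) :
    inner ℝ x ψ.val = x.fst * ψ.rep 0 + ∫ s in Ioo (-T) 0, x.snd s * ψ.rep s := by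
  rw [inner_state_eq, ψ.fst_eq]
  congr 1
  apply integral_congr_ae
  filter_upwards [ψ.snd_ae_eq] with s hs
  rw [hs]

theorem adjA_eq {T : ℝ} (x : StateSpace T) (ψ : DomA T) :
    adjA x ψ = ∫ s in Ioo (-T) 0, x.snd s * ψ.der s := by
  rw [adjA, inner_state_eq, DomA.opA]
  simp

/-- The states generated by a control solve the controlled state equation. -/
theorem IsStatePath.inner_eq {T : ℝ} (hT : 0 < T) {ι : L2Hist T} {j : ℝ → ℝ}
    (hj : ∀ R : ℝ, MemLp j 2 (volume.restrict (Icc 0 R))) {y : ℝ → StateSpace T}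
    (hy : IsStatePath ι j y) (hyc : ContinuousOn y (Ici 0)) (ψ : DomA T) {t : ℝ} (ht : 0 ≤ t) :
    inner ℝ (y t) ψ.val = inner ℝ (y 0) ψ.val +
      ∫ s in (0 : ℝ)..t, (adjA (y s) ψ + adjB (j s) ψ) := by
  set E := truncatedInvestment ι j t with hEdef
  have hE : Integrable E volume := integrable_truncatedInvestment hj
  have hEi : ∀ a b : ℝ, IntervalIntegrable E volume a b := fun a b => hE.intervalIntegrable
  have hsnd : ∀ τ ∈ Icc 0 t, (y τ).snd =ᵐ[histMeasure T] fun s => -E (τ - T - s) := by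
    intro τ hτ
    filter_upwards [(hy τ hτ.1).2, ae_restrict_mem measurableSet_Ioo] with s hs hs'
    rw [hs, hEdef, truncatedInvestment_eq ⟨by linarith [hs'.2, hτ.1], by linarith [hs'.1, hτ.2]⟩]
  have hD := ψ.der.intervalIntegrable hT
  have hval : ∀ τ ∈ Icc 0 t, inner ℝ (y τ) ψ.val =
      ∫ r in (-T)..0, ψ.der r * ∫ s in (τ - T - r)..τ, E s := by
    intro τ hτ
    rw [← window_pairing hT ψ hE, DomA.inner_val, (hy τ hτ.1).1, capital_eq_truncated hT hj hτ,
      ← setIntegral_Ioo_eq hT]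
    have e : ∫ s in Ioo (-T) 0, (y τ).snd s * ψ.rep s =
        -∫ s in Ioo (-T) 0, E (τ - T - s) * ψ.rep s := by
      rw [← integral_neg]
      apply integral_congr_ae
      filter_upwards [hsnd τ hτ] with s hs
      rw [hs]
      ring
    rw [e, ← sub_eq_add_neg]
  have hadjA : ∀ τ ∈ Icc 0 t, adjA (y τ) ψ = -∫ s in (-T)..0, E (τ - T - s) * ψ.der s := by
    intro τ hτ
    rw [adjA_eq, ← setIntegral_Ioo_eq hT, ← integral_neg]
    apply integral_congr_ae
    filter_upwards [hsnd τ hτ] with s hs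
    rw [hs]
    ring
  have hji : IntervalIntegrable j volume 0 t := by
    rw [intervalIntegrable_iff_integrableOn_Icc_of_le ht]
    exact (hj t).integrable (by norm_num)
  have hAi : IntervalIntegrable (fun s => adjA (y s) ψ) volume 0 t := by
    apply ContinuousOn.intervalIntegrable
    rw [uIcc_of_le ht]
    exact (hyc.mono Icc_subset_Ici_self).inner continuousOn_const
  have hEj : ∫ s in (0 : ℝ)..t, j s = ∫ s in (0 : ℝ)..t, E s := by
    rw [intervalIntegral.integral_of_le ht, intervalIntegral.integral_of_le ht]
    refine setIntegral_congr_fun measurableSet_Ioc fun s hs => ?_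
    rw [hEdef, truncatedInvestment_eq ⟨by linarith [hs.1], hs.2⟩]
    simp [investment, not_lt.2 hs.1.le]
  obtain ⟨P, hPc, hP⟩ : ∃ P : ℝ → ℝ, Continuous P ∧ ∀ a b : ℝ, ∫ s in a..b, E s = P b - P a :=
    ⟨fun x => ∫ s in (0 : ℝ)..x, E s, intervalIntegral.continuous_primitive hEi 0, fun a b => by
      rw [intervalIntegral.integral_interval_sub_left (hEi _ _) (hEi _ _)]⟩
  have hA : ∫ s in (0 : ℝ)..t, adjA (y s) ψ =
      -∫ s in (-T)..0, ψ.der s * ∫ r in (-T - s)..(t - T - s), E r := by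
    rw [← integral_window_pairing hT hD hE t, ← intervalIntegral.integral_neg]
    apply intervalIntegral.integral_congr
    intro τ hτ
    rw [uIcc_of_le ht] at hτ
    exact hadjA τ hτ
  have hB : ∫ s in (0 : ℝ)..t, adjB (j s) ψ = ∫ r in (-T)..0, ψ.der r * ∫ s in (0 : ℝ)..t, E s := by
    simp only [adjB]
    rw [intervalIntegral.integral_mul_const, intervalIntegral.integral_mul_const, hEj,
      DomA.intervalIntegral_der hT, mul_comm]
  have hcont : ∀ {g : ℝ → ℝ}, Continuous g →
      IntervalIntegrable (fun r => ψ.der r * g r) volume (-T) 0 :=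
    fun hg => hD.mul_continuousOn hg.continuousOn
  have hBi : IntervalIntegrable (fun s => adjB (j s) ψ) volume 0 t := hji.mul_const _
  rw [intervalIntegral.integral_add hAi hBi, hA, hB, hval t ⟨ht, le_rfl⟩, hval 0 ⟨le_rfl, ht⟩]
  -- Every term is now an integral of `ψ.der` against differences of the primitive `P`, and these
  -- differences cancel pointwise in `r`.
  simp_rw [hP]
  have c2 : Continuous fun r => P (t - T - r) - P (-T - r) := by fun_prop
  have c3 : Continuous fun r => P 0 - P (0 - T - r) := by fun_prop
  have c4 : Continuous fun _ : ℝ => P t - P 0 := by fun_prop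
  rw [neg_add_eq_sub, ← intervalIntegral.integral_sub (hcont c4) (hcont c2),
    ← intervalIntegral.integral_add (hcont c3) ((hcont c4).sub (hcont c2))]
  congr 1
  ext r
  rw [zero_sub]
  ring

/-! ### Smooth test elements and the equivalent capital. -/

open Filter Topology

theorem memLp_histMeasure {g : ℝ → ℝ} (hg : Continuous g) (T : ℝ) :
    MemLp g 2 (histMeasure T) := by
  obtain ⟨C, hC⟩ := isCompact_Icc.exists_bound_of_continuousOn (hg.continuousOn (s := Icc (-T) 0))
  refine MemLp.of_bound hg.aestronglyMeasurable C ?_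
  filter_upwards [ae_restrict_mem measurableSet_Ioo] with s hs
  exact hC s (Ioo_subset_Icc_self hs)

/-- The class in `L²(-T, 0)` of a continuous function. -/
noncomputable def histClass (T : ℝ) (g : ℝ → ℝ) (hg : Continuous g) : L2Hist T :=
  (memLp_histMeasure hg T).toLp g

theorem coeFn_histClass (T : ℝ) {g : ℝ → ℝ} (hg : Continuous g) :
    histClass T g hg =ᵐ[histMeasure T] g :=
  MemLp.coeFn_toLp _

theorem inner_histClass {T : ℝ} (f : L2Hist T) {g : ℝ → ℝ} (hg : Continuous g) :
    inner ℝ f (histClass T g hg) = ∫ s in Ioo (-T) 0, f s * g s := by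
  rw [L2.inner_def]
  apply integral_congr_ae
  filter_upwards [coeFn_histClass T hg] with s hs
  simp [hs, mul_comm]

/-- The element of `D(𝒜)` given by a `C¹` function. -/
noncomputable def contDom (T : ℝ) (g : ℝ → ℝ) (hg : ContDiff ℝ 1 g) : DomA T where
  val := WithLp.toLp 2 (g 0, histClass T g hg.continuous)
  rep := g
  der := histClass T (deriv g) (hg.continuous_deriv le_rfl)
  snd_ae_eq := coeFn_histClass T hg.continuous
  rep_eq := by
    intro s hs
    have h1 : ∫ r in s..0, histClass T (deriv g) (hg.continuous_deriv le_rfl) r =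
        ∫ r in s..0, deriv g r := by
      rw [intervalIntegral.integral_of_le hs.2, intervalIntegral.integral_of_le hs.2,
        integral_Ioc_eq_integral_Ioo, integral_Ioc_eq_integral_Ioo]
      apply integral_congr_ae
      exact ae_restrict_of_ae_restrict_of_subset (Ioo_subset_Ioo_left hs.1)
        (coeFn_histClass T (hg.continuous_deriv le_rfl))
    rw [h1, intervalIntegral.integral_deriv_eq_sub]
    · ring
    · exact fun x _ => hg.differentiable one_ne_zero x
    · exact (hg.continuous_deriv le_rfl).intervalIntegrable _ _
  fst_eq := rfl

theorem inner_contDom {T : ℝ} (x : StateSpace T) {g : ℝ → ℝ} (hg : ContDiff ℝ 1 g) :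
    inner ℝ x (contDom T g hg).val =
      x.fst * g 0 + inner ℝ x.snd (histClass T g hg.continuous) := by
  rw [WithLp.prod_inner_apply]
  simp [contDom, mul_comm]

theorem adjA_contDom {T : ℝ} (x : StateSpace T) {g : ℝ → ℝ} (hg : ContDiff ℝ 1 g) :
    adjA x (contDom T g hg) =
      inner ℝ x.snd (histClass T (deriv g) (hg.continuous_deriv le_rfl)) := by
  rw [adjA, WithLp.prod_inner_apply]
  simp [contDom, DomA.opA]

theorem opB_contDom {T : ℝ} {g : ℝ → ℝ} (hg : ContDiff ℝ 1 g) :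
    (contDom T g hg).opB = g 0 - g (-T) := rfl

theorem contDiff_exp_mul (ξ : ℝ) : ContDiff ℝ 1 fun s : ℝ => Real.exp (ξ * s) := by fun_prop

/-- This lets the weak equation be applied to the equivalent capital, and gives its linearity and
continuity. -/
theorem Gamma0_eq_inner {T : ℝ} (ξ : ℝ) (x : StateSpace T) :
    Gamma0 ξ x = inner ℝ x (contDom T _ (contDiff_exp_mul ξ)).val := by
  rw [inner_contDom, inner_histClass, Gamma0]
  simp [mul_comm]

theorem continuous_Gamma0 {T : ℝ} (ξ : ℝ) : Continuous (Gamma0 (T := T) ξ) := by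
  have : Gamma0 (T := T) ξ = fun x => inner ℝ x (contDom T _ (contDiff_exp_mul ξ)).val :=
    funext (Gamma0_eq_inner ξ)
  rw [this]
  fun_prop

theorem Gamma0_sub {T : ℝ} (ξ : ℝ) (x y : StateSpace T) :
    Gamma0 ξ (x - y) = Gamma0 ξ x - Gamma0 ξ y := by
  simp only [Gamma0_eq_inner, inner_sub_left]

theorem continuous_fst {T : ℝ} : Continuous fun x : StateSpace T => x.fst :=
  _root_.continuous_fst.comp (WithLp.prod_continuous_ofLp 2 ℝ (L2Hist T))

theorem continuous_snd {T : ℝ} : Continuous fun x : StateSpace T => x.snd :=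
  _root_.continuous_snd.comp (WithLp.prod_continuous_ofLp 2 ℝ (L2Hist T))

/-- The evolution of the equivalent capital in differential form. -/
theorem adjA_add_adjB_exp {T A ξ : ℝ} (hA : A ≠ 0) (hξ : ξ = A * (1 - Real.exp (-ξ * T)))
    (x : StateSpace T) (u : ℝ) :
    adjA x (contDom T _ (contDiff_exp_mul ξ)) + adjB u (contDom T _ (contDiff_exp_mul ξ)) =
      ξ * Gamma0 ξ x - ξ / A * (A * x.fst - u) := by
  have hd : deriv (fun s : ℝ => Real.exp (ξ * s)) = fun s => ξ * Real.exp (ξ * s) := by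
    ext s
    have := ((hasDerivAt_id s).const_mul ξ).exp
    simpa [mul_comm] using this.deriv
  rw [adjA_contDom, inner_histClass, adjB, opB_contDom, Gamma0, hd]
  have e1 : ∫ s in Ioo (-T) 0, x.snd s * (ξ * Real.exp (ξ * s)) =
      ξ * ∫ s in Ioo (-T) 0, Real.exp (ξ * s) * x.snd s := by
    rw [← integral_const_mul]
    congr 1
    ext s
    ring
  -- The characteristic equation of `ξ` enters here: it turns the delayed input into a multiple of
  -- `u`.
  have e2 : Real.exp (ξ * 0) - Real.exp (ξ * -T) = ξ / A := by
    rw [mul_zero, Real.exp_zero, mul_neg, ← neg_mul, eq_div_iff hA, mul_comm]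
    exact hξ.symm
  rw [e1, e2]
  field_simp
  ring

/-! ### Duality with translations and uniqueness. -/

/-- A Taylor remainder uniform in `x`, as needed to differentiate translations in `L²`. -/
theorem norm_sub_sub_mul_le_of_lipschitz {g : ℝ → ℝ} {C : ℝ} (hg : Differentiable ℝ g)
    (hC : ∀ x y, |deriv g x - deriv g y| ≤ C * |x - y|) (hC0 : 0 ≤ C) (x h : ℝ) :
    |g (x + h) - g x - h * deriv g x| ≤ C * |h| ^ 2 := by
  have hd : ∀ u ∈ uIcc 0 h, HasDerivWithinAt (fun u => g (x + u) - u * deriv g x)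
      (deriv g (x + u) - deriv g x) (uIcc 0 h) u := by
    intro u _
    have h1 := ((hg (x + u)).hasDerivAt.comp_const_add x u)
    have h2 := (hasDerivAt_id u).mul_const (deriv g x)
    have := (h1.sub h2).hasDerivWithinAt (s := uIcc 0 h)
    rw [one_mul] at this
    exact this
  have hb : ∀ u ∈ uIcc 0 h, ‖deriv g (x + u) - deriv g x‖ ≤ C * |h| := by
    intro u hu
    have h1 := hC (x + u) x
    rw [add_sub_cancel_left] at h1
    have h2 : |u| ≤ |h| := by
      have := abs_sub_left_of_mem_uIcc hu
      simpa using this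
    exact h1.trans (mul_le_mul_of_nonneg_left h2 hC0)
  have := (convex_uIcc 0 h).norm_image_sub_le_of_norm_hasDerivWithin_le hd hb
    left_mem_uIcc right_mem_uIcc
  simp only [add_zero, zero_mul, sub_zero, Real.norm_eq_abs] at this
  rw [show g (x + h) - g x - h * deriv g x = g (x + h) - h * deriv g x - g x by ring]
  calc _ ≤ C * |h| * |h| := this
    _ = _ := by ring

theorem norm_histClass_le (T : ℝ) {g : ℝ → ℝ} (hg : Continuous g) {C : ℝ} (hC0 : 0 ≤ C)
    (hC : ∀ s, |g s| ≤ C) :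
    ‖histClass T g hg‖ ≤ ((measureUnivNNReal (histMeasure T) : ℝ) ^ (2 : ℝ≥0∞).toReal⁻¹) * C := by
  refine Lp.norm_le_of_ae_bound hC0 ?_
  filter_upwards [coeFn_histClass T hg] with s hs
  rw [hs]
  exact hC s

/-- Translation of a function with Lipschitz derivative is differentiable in `L²`. -/
theorem hasDerivAt_histClass_translate (T : ℝ) {g : ℝ → ℝ} {C : ℝ} (hg : ContDiff ℝ 1 g)
    (hC : ∀ x y, |deriv g x - deriv g y| ≤ C * |x - y|) (hC0 : 0 ≤ C) (r : ℝ) :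
    HasDerivAt (fun r => histClass T (fun s => g (s + r))
        (hg.continuous.comp (continuous_id.add continuous_const)))
      (histClass T (fun s => deriv g (s + r))
        ((hg.continuous_deriv le_rfl).comp (continuous_id.add continuous_const))) r := by
  have hgc := hg.continuous
  have hgc' := hg.continuous_deriv le_rfl
  rw [hasDerivAt_iff_isLittleO_nhds_zero]
  refine Asymptotics.IsBigO.trans_isLittleO (g := fun h : ℝ => h ^ 2) ?_ ?_
  · apply Asymptotics.IsBigO.of_bound
      (((measureUnivNNReal (histMeasure T) : ℝ) ^ (2 : ℝ≥0∞).toReal⁻¹) * C)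
    refine Eventually.of_forall fun h => ?_
    rw [norm_pow, Real.norm_eq_abs, mul_assoc]
    refine norm_histClass_le T
      (g := fun s => g (s + (r + h)) - g (s + r) - h * deriv g (s + r)) (by fun_prop)
      (by positivity) fun s => ?_
    rw [← add_assoc]
    exact norm_sub_sub_mul_le_of_lipschitz (hg.differentiable one_ne_zero) hC hC0 (s + r) h
  · simpa using (Asymptotics.isLittleO_pow_id (𝕜 := ℝ) (n := 2) (by norm_num))

open scoped ContDiff

/-- Compact support is asked of the derivative only, so that test functions equal to `1` on `[0, ∞)`
are allowed too. -/
theorem exists_lipschitz_deriv {g : ℝ → ℝ} (hg : ContDiff ℝ ∞ g)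
    (hs : HasCompactSupport (deriv g)) :
    ∃ C : ℝ, 0 ≤ C ∧ ∀ x y, |deriv g x - deriv g y| ≤ C * |x - y| := by
  have hd : ContDiff ℝ 1 (deriv g) :=
    (contDiff_infty_iff_deriv.1 hg).2.of_le (by exact_mod_cast le_top)
  obtain ⟨C, hC⟩ := hd.lipschitzWith_of_hasCompactSupport hs one_ne_zero
  exact ⟨C, C.2, fun x y => by simpa [Real.dist_eq] using hC.dist_le_mul x y⟩

theorem eq_zero_of_integral_eq_zero {E : Type*} [NormedAddCommGroup E] [NormedSpace ℝ E]
    [CompleteSpace E] {f : ℝ → E} (hf : Continuous f)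
    (h : ∀ t, 0 ≤ t → ∫ s in (0 : ℝ)..t, f s = 0) {t : ℝ} (ht : 0 ≤ t) : f t = 0 := by
  have h1 : HasDerivWithinAt (fun t => ∫ s in (0 : ℝ)..t, f s) (f t) (Ici t) t :=
    (hf.integral_hasStrictDerivAt 0 t).hasDerivAt.hasDerivWithinAt
  have h2 : HasDerivWithinAt (fun t => ∫ s in (0 : ℝ)..t, f s) 0 (Ici t) t :=
    (hasDerivWithinAt_const t (Ici t) (0 : E)).congr (fun s hs => h s (ht.trans hs)) (h t ht)
  exact (uniqueDiffOn_Ici t t self_mem_Ici).eq_deriv _ h1 h2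

/-- Gronwall's lemma, applied to the primitive of `|f|`. -/
theorem eq_zero_of_abs_le_integral {f : ℝ → ℝ} {C : ℝ} (hf : Continuous f)
    (h : ∀ t, 0 ≤ t → |f t| ≤ C * ∫ s in (0 : ℝ)..t, |f s|) {t : ℝ} (ht : 0 ≤ t) : f t = 0 := by
  have hd : ∀ s, HasDerivAt (fun t => ∫ s in (0 : ℝ)..t, |f s|) |f s| s :=
    fun s => (hf.abs.integral_hasStrictDerivAt 0 s).hasDerivAt
  have := eq_zero_of_abs_deriv_le_mul_abs_self_of_eq_zero_right (K := C) (a := 0) (b := t)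
    (f := fun t => ∫ s in (0 : ℝ)..t, |f s|) (f' := fun s => |f s|)
    (fun s _ => (hd s).continuousAt.continuousWithinAt)
    (fun s _ => (hd s).hasDerivWithinAt) intervalIntegral.integral_same
    (fun s hs => by
      rw [Real.norm_eq_abs, abs_abs, Real.norm_eq_abs,
        abs_of_nonneg (intervalIntegral.integral_nonneg hs.1 fun _ _ => abs_nonneg _)]
      exact h s hs.1) t ⟨ht, le_rfl⟩
  have h2 := h t ht
  rw [this, mul_zero] at h2
  exact abs_eq_zero.1 (le_antisymm h2 (abs_nonneg _))

/-- `w` solves `w' = 𝒜^* w + B^* u`, `w(0) = 0`, in the weak sense. -/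
def SolvesFromZero {T : ℝ} (w : ℝ → StateSpace T) (u : ℝ → ℝ) : Prop :=
  ∀ ψ : DomA T, ∀ t : ℝ, 0 ≤ t →
    inner ℝ (w t) ψ.val = ∫ s in (0 : ℝ)..t, (adjA (w s) ψ + adjB (u s) ψ)

/-- Duality with the translation semigroup. -/
theorem SolvesFromZero.inner_integral {T : ℝ} {w : ℝ → StateSpace T} {u : ℝ → ℝ}
    (hw : SolvesFromZero w u) (hwc : Continuous w) (hu : Continuous u) {g : ℝ → ℝ}
    (hg : ContDiff ℝ ∞ g) (hs : HasCompactSupport (deriv g)) {t : ℝ} (ht : 0 ≤ t) :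
    inner ℝ (∫ s in (0 : ℝ)..t, (w s).snd) (histClass T g hg.continuous) =
      ∫ τ in (0 : ℝ)..t, ((∫ s in (0 : ℝ)..τ, u s) * (g (t - τ) - g (-T + (t - τ))) -
        (w τ).fst * g (t - τ)) := by
  obtain ⟨C, hC0, hC⟩ := exists_lipschitz_deriv hg hs
  have hg1 : ContDiff ℝ 1 g := hg.of_le (by exact_mod_cast le_top)
  have hgc := hg.continuous
  have hgc' := hg1.continuous_deriv le_rfl
  have hsndc : Continuous fun s => (w s).snd := continuous_snd.comp hwc
  have hfstc : Continuous fun s => (w s).fst := continuous_fst.comp hwc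
  have hU : Continuous fun τ => ∫ s in (0 : ℝ)..τ, u s :=
    intervalIntegral.continuous_primitive (fun a b => hu.intervalIntegrable a b) 0
  have hder : ∀ τ ∈ uIcc 0 t, HasDerivAt (fun τ => inner ℝ (∫ s in (0 : ℝ)..τ, (w s).snd)
      (histClass T (fun s => g (s + (t - τ))) (by fun_prop)))
      ((∫ s in (0 : ℝ)..τ, u s) * (g (t - τ) - g (-T + (t - τ))) - (w τ).fst * g (t - τ)) τ := by
    intro τ hτ
    rw [uIcc_of_le ht] at hτ
    have h1 := (hsndc.integral_hasStrictDerivAt 0 τ).hasDerivAt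
    have h2 := (hasDerivAt_histClass_translate T hg1 hC hC0 (t - τ)).scomp τ
      ((hasDerivAt_id τ).const_sub t)
    have h3 := h1.inner ℝ h2
    refine h3.congr_deriv ?_
    have hgr : ContDiff ℝ 1 fun s => g (s + (t - τ)) := by fun_prop
    -- The equation at time `τ` is tested with `g` translated by `t - τ`; the terms containing
    -- `deriv g` cancel against the derivative of the translation.
    have h4 := hw (contDom T _ hgr) τ hτ.1
    have hi : ∫ s in (0 : ℝ)..τ, inner ℝ (w s).snd
        (histClass T (fun s => deriv g (s + (t - τ))) (by fun_prop)) =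
        inner ℝ (∫ s in (0 : ℝ)..τ, (w s).snd)
          (histClass T (fun s => deriv g (s + (t - τ))) (by fun_prop)) := by
      rw [real_inner_comm]
      refine Eq.trans ?_ ((innerSL ℝ _).intervalIntegral_comp_comm
        (hsndc.intervalIntegrable _ _))
      congr 1
      ext s
      exact real_inner_comm _ _
    rw [inner_contDom] at h4
    have hd : deriv (fun s => g (s + (t - τ))) = fun s => deriv g (s + (t - τ)) :=
      funext fun s => deriv_comp_add_const g (t - τ) s
    simp only [adjA_contDom, adjB, opB_contDom, hd] at h4
    rw [intervalIntegral.integral_add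
      ((hsndc.inner continuous_const).intervalIntegrable _ _)
      ((hu.intervalIntegrable _ _).mul_const _), intervalIntegral.integral_mul_const,
      hi, zero_add] at h4
    rw [neg_one_smul, inner_neg_right]
    simp only [Function.comp_apply]
    linarith
  have key := intervalIntegral.integral_eq_sub_of_hasDerivAt hder
    (Continuous.intervalIntegrable (by fun_prop) _ _)
  rw [key]
  simp

/-- Smooth approximations of the indicator function of `[0, ∞)`. -/
theorem contDiff_transition (n : ℕ) :
    ContDiff ℝ ∞ fun s : ℝ => Real.smoothTransition (1 + (n + 1) * s) :=
  Real.smoothTransition.contDiff.comp (by fun_prop)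

theorem hasCompactSupport_deriv_transition (n : ℕ) :
    HasCompactSupport (deriv fun s : ℝ => Real.smoothTransition (1 + (n + 1) * s)) := by
  refine HasCompactSupport.intro (isCompact_Icc (a := -1) (b := 0)) fun s hs => ?_
  have hn : (0 : ℝ) ≤ n := n.cast_nonneg
  rcases lt_or_ge s (-1) with h | h
  · have : (fun s : ℝ => Real.smoothTransition (1 + (n + 1) * s)) =ᶠ[𝓝 s] fun _ => 0 := by
      filter_upwards [Iio_mem_nhds h] with x hx
      have hx' : x < -1 := hx
      exact Real.smoothTransition.zero_of_nonpos (by nlinarith)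
    rw [this.deriv_eq, deriv_const]
  · have h' : 0 < s := by
      by_contra h'
      exact hs ⟨h, not_lt.1 h'⟩
    have : (fun s : ℝ => Real.smoothTransition (1 + (n + 1) * s)) =ᶠ[𝓝 s] fun _ => 1 := by
      filter_upwards [Ioi_mem_nhds h'] with x hx
      have hx' : 0 < x := hx
      exact Real.smoothTransition.one_of_one_le (by nlinarith)
    rw [this.deriv_eq, deriv_const]

/-- In the limit these test functions ignore the history and retain only the value at `0`, which
isolates the first component of a state. -/
theorem tendsto_inner_transition {T : ℝ} (f : L2Hist T) :
    Tendsto (fun n : ℕ => inner ℝ f (histClass T _ (contDiff_transition n).continuous))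
      atTop (𝓝 0) := by
  simp_rw [inner_histClass]
  have hfi : Integrable f (histMeasure T) := (Lp.memLp f).integrable (by norm_num)
  suffices h : Tendsto (fun n : ℕ => ∫ s in Ioo (-T) 0,
      f s * Real.smoothTransition (1 + (n + 1) * s)) atTop
      (𝓝 (∫ s in Ioo (-T) 0, (0 : ℝ))) by simpa using h
  refine tendsto_integral_of_dominated_convergence (fun s => ‖f s‖)
    (fun n => hfi.aestronglyMeasurable.mul
      (contDiff_transition n).continuous.aestronglyMeasurable) hfi.norm ?_ ?_
  · intro n
    refine Eventually.of_forall fun s => ?_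
    rw [norm_mul]
    refine mul_le_of_le_one_right (norm_nonneg _) ?_
    rw [Real.norm_eq_abs, abs_of_nonneg (Real.smoothTransition.nonneg _)]
    exact Real.smoothTransition.le_one _
  · filter_upwards [ae_restrict_mem measurableSet_Ioo] with s hs
    refine tendsto_const_nhds.congr' ?_
    obtain ⟨N, hN⟩ := exists_nat_gt (1 / (-s))
    filter_upwards [eventually_ge_atTop N] with n hn
    have hs0 : 0 < -s := by linarith [hs.2]
    have h1 : (1 : ℝ) < N * (-s) := by rwa [div_lt_iff₀ hs0] at hN
    have h2 : (N : ℝ) ≤ n := by exact_mod_cast hn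
    rw [Real.smoothTransition.zero_of_nonpos (by nlinarith), mul_zero]

theorem eq_zero_of_inner_histClass {T : ℝ} {f : L2Hist T}
    (h : ∀ g : ℝ → ℝ, (hg : ContDiff ℝ ∞ g) → HasCompactSupport g →
      inner ℝ f (histClass T g hg.continuous) = 0) : f = 0 := by
  have hfi : Integrable f (histMeasure T) := (Lp.memLp f).integrable (by norm_num)
  have h0 : ∀ᵐ s ∂(volume : Measure ℝ), (Ioo (-T) 0).indicator f s = 0 := by
    apply ae_eq_zero_of_integral_contDiff_smul_eq_zero
    · exact ((integrable_indicator_iff measurableSet_Ioo).2 hfi).locallyIntegrable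
    · intro g hg hgs
      refine Eq.trans ?_ (h g hg hgs)
      rw [inner_histClass, ← integral_indicator measurableSet_Ioo]
      congr 1
      ext s
      by_cases hs : s ∈ Ioo (-T) 0 <;> simp [hs, mul_comm]
  apply Lp.ext
  filter_upwards [ae_restrict_of_ae h0, ae_restrict_mem measurableSet_Ioo,
    Lp.coeFn_zero ℝ 2 (histMeasure T)] with s hs hs' h3
  rw [indicator_of_mem hs'] at hs
  rw [hs, h3, Pi.zero_apply]

/-- A solution from zero whose input is proportional to its first component vanishes. -/
theorem SolvesFromZero.eq_zero {T A : ℝ} {w : ℝ → StateSpace T} (hA : 0 ≤ A)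
    (hw : SolvesFromZero w fun s => A * (w s).fst) (hwc : Continuous w) {t : ℝ} (ht : 0 ≤ t) :
    w t = 0 := by
  have hsndc : Continuous fun s => (w s).snd := continuous_snd.comp hwc
  have hfstc : Continuous fun s => (w s).fst := continuous_fst.comp hwc
  have huc : Continuous fun s => A * (w s).fst := continuous_const.mul hfstc
  have hKc : Continuous fun τ => ∫ s in (0 : ℝ)..τ, (w s).fst :=
    intervalIntegral.continuous_primitive (fun a b => hfstc.intervalIntegrable a b) 0
  have hK : ∀ t, 0 ≤ t → ∫ s in (0 : ℝ)..t, (w s).fst = 0 := by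
    intro t ht
    refine eq_zero_of_abs_le_integral (C := A) hKc ?_ ht
    intro t ht
    -- In the duality identity the transition functions equal `1` at `t - τ ≥ 0`. What remains of
    -- the input is `A ∫ w⁰` times a factor in `[0, 1]`, which gives a Gronwall bound for `∫ w⁰`.
    have hlim := ((tendsto_inner_transition (∫ s in (0 : ℝ)..t, (w s).snd)).add_const
      (∫ s in (0 : ℝ)..t, (w s).fst)).abs
    rw [zero_add] at hlim
    refine le_of_tendsto hlim (Eventually.of_forall fun n => ?_)
    have hgc := (contDiff_transition n).continuous
    rw [hw.inner_integral hwc huc (contDiff_transition n)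
      (hasCompactSupport_deriv_transition n) ht,
      ← intervalIntegral.integral_add (Continuous.intervalIntegrable (by
        simp only [intervalIntegral.integral_const_mul]; fun_prop) _ _)
        (hfstc.intervalIntegrable _ _), ← intervalIntegral.integral_const_mul]
    rw [← Real.norm_eq_abs]
    refine intervalIntegral.norm_integral_le_of_norm_le ht ?_
      (Continuous.intervalIntegrable (by fun_prop) _ _)
    refine Eventually.of_forall fun τ hτ => ?_
    have hn : (0 : ℝ) ≤ n := n.cast_nonneg
    have h1 : Real.smoothTransition (1 + (n + 1) * (t - τ)) = 1 :=
      Real.smoothTransition.one_of_one_le (by nlinarith [hτ.2])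
    have h2 := Real.smoothTransition.nonneg (1 + (n + 1) * (-T + (t - τ)))
    have h3 := Real.smoothTransition.le_one (1 + (n + 1) * (-T + (t - τ)))
    rw [h1, mul_one, sub_add_cancel, norm_mul, intervalIntegral.integral_const_mul, norm_mul,
      Real.norm_eq_abs, Real.norm_eq_abs, Real.norm_eq_abs, abs_of_nonneg hA,
      abs_of_nonneg (by linarith : 0 ≤ 1 - Real.smoothTransition (1 + (n + 1) * (-T + (t - τ))))]
    exact mul_le_of_le_one_right (by positivity) (by linarith)
  have hk : ∀ t, 0 ≤ t → (w t).fst = 0 := fun t ht => eq_zero_of_integral_eq_zero hfstc hK ht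
  -- With `w⁰ = 0` the right side of the duality identity vanishes for every test function.
  have hH : ∀ t, 0 ≤ t → ∫ s in (0 : ℝ)..t, (w s).snd = 0 := by
    intro t ht
    refine eq_zero_of_inner_histClass fun g hg hgs => ?_
    rw [hw.inner_integral hwc huc hg hgs.deriv ht,
      intervalIntegral.integral_congr (g := fun _ => 0), intervalIntegral.integral_zero]
    intro τ hτ
    rw [uIcc_of_le ht] at hτ
    simp only [intervalIntegral.integral_const_mul]
    rw [hK τ hτ.1, hk τ hτ.1]
    ring
  have hh := eq_zero_of_integral_eq_zero hsndc hH ht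
  apply WithLp.ofLp_injective 2
  exact Prod.ext (hk t ht) hh

theorem feedback_sub {T A σ ρ ξ : ℝ} (x y : StateSpace T) :
    feedback A σ ρ ξ (x - y) = feedback A σ ρ ξ x - feedback A σ ρ ξ y := by
  simp only [feedback, Gamma0_sub, WithLp.sub_fst]
  ring

theorem continuous_feedback {T A σ ρ ξ : ℝ} : Continuous (feedback (T := T) A σ ρ ξ) :=
  (continuous_const.mul continuous_fst).sub (continuous_const.mul (continuous_Gamma0 ξ))

theorem continuous_adjA {T : ℝ} (ψ : DomA T) : Continuous fun x : StateSpace T => adjA x ψ :=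
  continuous_id.inner continuous_const

/-- The closed-loop equation has at most one solution. -/
theorem IsClosedLoopSolution.eqOn {T A σ ρ ξ : ℝ} (hA : 0 < A)
    (hξ : ξ = A * (1 - Real.exp (-ξ * T))) {x : StateSpace T} {y z : ℝ → StateSpace T}
    (hy : IsClosedLoopSolution (feedback A σ ρ ξ) x y)
    (hz : IsClosedLoopSolution (feedback A σ ρ ξ) x z) : EqOn z y (Ici 0) := by
  -- Freezing the solutions at negative times makes them continuous on `ℝ`.
  have hm : Continuous fun t : ℝ => max t 0 := by fun_prop
  have hext : ∀ {v : ℝ → StateSpace T}, ContinuousOn v (Ici 0) →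
      Continuous fun t => v (max t 0) := fun hv =>
    hv.comp_continuous hm fun t => le_max_right t 0
  have hyc := hext hy.1
  have hzc := hext hz.1
  set w : ℝ → StateSpace T := fun t => z (max t 0) - y (max t 0) with hwdef
  have hwc : Continuous w := hzc.sub hyc
  have hfc : Continuous fun s => feedback A σ ρ ξ (w s) := continuous_feedback.comp hwc
  have hsol : SolvesFromZero w fun s => feedback A σ ρ ξ (w s) := by
    intro ψ t ht
    have hint : ∀ {v : ℝ → StateSpace T}, ContinuousOn v (Ici 0) →
        IntervalIntegrable (fun s => adjA (v s) ψ + adjB (feedback A σ ρ ξ (v s)) ψ)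
          volume 0 t := by
      intro v hv
      apply ContinuousOn.intervalIntegrable
      rw [uIcc_of_le ht]
      have hv' := hv.mono (Icc_subset_Ici_self : Icc 0 t ⊆ Ici 0)
      exact ((continuous_adjA ψ).comp_continuousOn hv').add
        ((continuous_feedback.comp_continuousOn hv').mul continuousOn_const)
    have hwt : ∀ s, 0 ≤ s → w s = z s - y s := fun s hs => by simp [hwdef, hs]
    rw [hwt t ht, inner_sub_left, hz.2.2 ψ t ht, hy.2.2 ψ t ht, add_sub_add_left_eq_sub,
      ← intervalIntegral.integral_sub (hint hz.1) (hint hy.1)]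
    apply intervalIntegral.integral_congr
    intro s hs
    rw [uIcc_of_le ht] at hs
    simp only [hwt s hs.1, feedback_sub, adjA, adjB, inner_sub_left]
    ring
  -- `A w⁰ - φ(w)` is a multiple of `Γ₀(w)`, so `Γ₀(w)` solves a homogeneous scalar equation from
  -- `0`.
  have hΓ : ∀ t, 0 ≤ t → Gamma0 ξ (w t) = 0 := by
    intro t ht
    have hΓc : Continuous fun s => Gamma0 ξ (w s) := (continuous_Gamma0 ξ).comp hwc
    have := exp_neg_mul_eq_of_integral_eq (G := fun s => Gamma0 ξ (w s)) (c := fun _ => 0)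
      (κ := ξ - ξ / A * (nu A σ ρ ξ ^ (-1 / σ) * (A / ξ) ^ (1 / σ))) (G₀ := 0) ht
      (hΓc.intervalIntegrable _ _) (continuous_const.intervalIntegrable _ _) ?_
    · simpa using this
    · intro s hs
      rw [Gamma0_eq_inner, hsol _ s hs.1, zero_add]
      congr 1
      ext r
      rw [adjA_add_adjB_exp hA.ne' hξ]
      simp only [feedback]
      ring
  intro t ht
  have hsol' : SolvesFromZero w fun s => A * (w s).fst := by
    intro ψ t ht
    rw [hsol ψ t ht]
    apply intervalIntegral.integral_congr
    intro s hs
    rw [uIcc_of_le ht] at hs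
    simp only [feedback, hΓ s hs.1, mul_zero, sub_zero]
  have h0 := hsol'.eq_zero hA.le hwc ht
  have ht' : (0 : ℝ) ≤ t := ht
  simp only [hwdef, max_eq_left ht'] at h0
  exact sub_eq_zero.1 h0

/-! ### Controls with prescribed consumption. -/

open scoped BoundedContinuousFunction

theorem abs_integral_exp_mul_le {l a b C : ℝ} (hl : 0 < l) (hab : a ≤ b) (hC : 0 ≤ C)
    {j : ℝ → ℝ} (hj : ∀ s, |j s| ≤ C) :
    |∫ s in a..b, Real.exp (l * s) * j s| ≤ C / l * Real.exp (l * b) := by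
  have h1 : |∫ s in a..b, Real.exp (l * s) * j s| ≤ ∫ s in a..b, C * Real.exp (l * s) := by
    rw [← Real.norm_eq_abs]
    refine intervalIntegral.norm_integral_le_of_norm_le hab
      (Eventually.of_forall fun s _ => ?_) (Continuous.intervalIntegrable (by fun_prop) _ _)
    rw [norm_mul, Real.norm_eq_abs, Real.norm_eq_abs, abs_of_pos (Real.exp_pos _), mul_comm]
    exact mul_le_mul_of_nonneg_right (hj s) (Real.exp_pos _).le
  have h2 : ∫ s in a..b, C * Real.exp (l * s) =
      C / l * Real.exp (l * b) - C / l * Real.exp (l * a) := by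
    apply intervalIntegral.integral_eq_sub_of_hasDerivAt (f := fun s => C / l * Real.exp (l * s))
    · intro s _
      have := (((hasDerivAt_id s).const_mul l).exp).const_mul (C / l)
      refine this.congr_deriv ?_
      simp only [id]
      field_simp
    · exact Continuous.intervalIntegrable (by fun_prop) _ _
  have h3 : 0 ≤ C / l * Real.exp (l * a) := by positivity
  linarith

/-- Existence for a linear Volterra equation with delay. -/
theorem exists_volterra_delay {f : ℝ → ℝ} (hf : Continuous f) {T A l M : ℝ} (hT : 0 ≤ T)
    (hA : 0 ≤ A) (hl : A < l) (hM : ∀ t, 0 ≤ t → |f t| ≤ M * Real.exp (l * t)) :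
    ∃ i : ℝ → ℝ, Continuous i ∧
      ∀ t, 0 ≤ t → i t = f t + A * ∫ s in (max (t - T) 0)..t, i s := by
  have hl0 : 0 < l := hA.trans_lt hl
  -- The Volterra map for `i`, written for `j = exp (-l t) i`: in this weight the integral term
  -- contracts with ratio `A / l < 1`. The `max t 0` extends it to all real times.
  let F : (ℝ → ℝ) → ℝ → ℝ := fun j t => Real.exp (-(l * max t 0)) *
    (f (max t 0) + A * ∫ s in (max (max t 0 - T) 0)..(max t 0), Real.exp (l * s) * j s)
  have hFc : ∀ j : ℝ → ℝ, Continuous j → Continuous (F j) := by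
    intro j hj
    have hi : ∀ a b : ℝ, IntervalIntegrable (fun s => Real.exp (l * s) * j s) volume a b :=
      fun a b => Continuous.intervalIntegrable (by fun_prop) _ _
    have hP := intervalIntegral.continuous_primitive hi 0
    have h : F j = fun t => Real.exp (-(l * max t 0)) * (f (max t 0) +
        A * ((∫ s in (0 : ℝ)..(max t 0), Real.exp (l * s) * j s) -
          ∫ s in (0 : ℝ)..(max (max t 0 - T) 0), Real.exp (l * s) * j s)) := by
      ext t
      rw [intervalIntegral.integral_interval_sub_left (hi _ _) (hi _ _)]
    rw [h]
    have hP1 : Continuous fun t : ℝ => ∫ s in (0 : ℝ)..(max t 0), Real.exp (l * s) * j s :=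
      hP.comp (by fun_prop : Continuous fun t : ℝ => max t 0)
    have hP2 : Continuous fun t : ℝ =>
        ∫ s in (0 : ℝ)..(max (max t 0 - T) 0), Real.exp (l * s) * j s :=
      hP.comp (by fun_prop : Continuous fun t : ℝ => max (max t 0 - T) 0)
    fun_prop
  have hle : ∀ t : ℝ, max (max t 0 - T) 0 ≤ max t 0 := fun t =>
    max_le (by linarith) (le_max_right _ _)
  have hexp : ∀ t : ℝ, Real.exp (-(l * max t 0)) * Real.exp (l * max t 0) = 1 := fun t => by
    rw [← Real.exp_add, neg_add_cancel, Real.exp_zero]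
  have hFb : ∀ (j : ℝ →ᵇ ℝ) t, ‖F j t‖ ≤ M + A * (‖j‖ / l) := by
    intro j t
    have h1 := hM (max t 0) (le_max_right _ _)
    have h2 := abs_integral_exp_mul_le hl0 (hle t) (norm_nonneg j) (fun s => j.norm_coe_le_norm s)
    rw [Real.norm_eq_abs, abs_mul, abs_of_pos (Real.exp_pos _)]
    calc Real.exp (-(l * max t 0)) * |f (max t 0) +
          A * ∫ s in (max (max t 0 - T) 0)..(max t 0), Real.exp (l * s) * j s|
        ≤ Real.exp (-(l * max t 0)) * (M * Real.exp (l * max t 0) +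
          A * (‖j‖ / l * Real.exp (l * max t 0))) := by
          refine mul_le_mul_of_nonneg_left ((abs_add_le _ _).trans (add_le_add h1 ?_))
            (Real.exp_pos _).le
          rw [abs_mul, abs_of_nonneg hA]
          exact mul_le_mul_of_nonneg_left h2 hA
      _ = (Real.exp (-(l * max t 0)) * Real.exp (l * max t 0)) * (M + A * (‖j‖ / l)) := by ring
      _ = _ := by rw [hexp, one_mul]
  let Φ : (ℝ →ᵇ ℝ) → (ℝ →ᵇ ℝ) := fun j =>
    BoundedContinuousFunction.ofNormedAddCommGroup (F j) (hFc j j.continuous) _ (hFb j)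
  have hΦ : ContractingWith (Real.toNNReal (A / l)) Φ := by
    refine ⟨?_, LipschitzWith.of_dist_le_mul fun j₁ j₂ => ?_⟩
    · rw [← Real.toNNReal_one]
      exact (Real.toNNReal_lt_toNNReal_iff one_pos).2 ((div_lt_one hl0).2 hl)
    · rw [Real.coe_toNNReal _ (by positivity)]
      refine (BoundedContinuousFunction.dist_le (by positivity)).2 fun t => ?_
      have hi : ∀ j : ℝ →ᵇ ℝ, IntervalIntegrable (fun s => Real.exp (l * s) * j s) volume
          (max (max t 0 - T) 0) (max t 0) :=
        fun j => Continuous.intervalIntegrable (by have := j.continuous; fun_prop) _ _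
      have h2 := abs_integral_exp_mul_le hl0 (hle t) (dist_nonneg (x := j₁) (y := j₂))
        (j := fun s => j₁ s - j₂ s)
        (fun s => by
          rw [← Real.dist_eq]
          exact BoundedContinuousFunction.dist_coe_le_dist s)
      have h3 : F j₁ t - F j₂ t = Real.exp (-(l * max t 0)) *
          (A * ∫ s in (max (max t 0 - T) 0)..(max t 0), Real.exp (l * s) * (j₁ s - j₂ s)) := by
        simp_rw [mul_sub]
        rw [intervalIntegral.integral_sub (hi j₁) (hi j₂)]
        ring
      change dist (F j₁ t) (F j₂ t) ≤ _
      rw [Real.dist_eq, h3, abs_mul, abs_mul, abs_of_pos (Real.exp_pos _), abs_of_nonneg hA]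
      calc _ ≤ Real.exp (-(l * max t 0)) * (A * (dist j₁ j₂ / l * Real.exp (l * max t 0))) := by
            gcongr
        _ = (Real.exp (-(l * max t 0)) * Real.exp (l * max t 0)) * (A / l * dist j₁ j₂) := by ring
        _ = _ := by rw [hexp, one_mul]
  obtain ⟨j, hj⟩ : ∃ j : ℝ →ᵇ ℝ, Φ j = j := ⟨_, hΦ.fixedPoint_isFixedPt⟩
  refine ⟨fun t => Real.exp (l * t) * j t, by have := j.continuous; fun_prop, fun t ht => ?_⟩
  have h1 : j t = F j t := by
    conv_lhs => rw [← hj]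
    rfl
  have h2 := hexp t
  simp only [F, max_eq_left ht] at h1 h2
  simp only
  rw [h1, ← mul_assoc, mul_comm (Real.exp (l * t)), h2, one_mul]

theorem memLp_of_continuous {i : ℝ → ℝ} (hi : Continuous i) (R : ℝ) :
    MemLp i 2 (volume.restrict (Icc 0 R)) := by
  obtain ⟨C, hC⟩ := isCompact_Icc.exists_bound_of_continuousOn (hi.continuousOn (s := Icc 0 R))
  refine MemLp.of_bound hi.aestronglyMeasurable C ?_
  filter_upwards [ae_restrict_mem measurableSet_Icc] with s hs
  exact hC s hs

theorem capital_eq_add {T : ℝ} (hT : 0 < T) (ι : L2Hist T) {i : ℝ → ℝ} (hi : Continuous i)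
    {t : ℝ} (ht : 0 ≤ t) :
    capital ι i t = (∫ s in (t - T)..t, (Ioo (-T) 0).indicator ι s) +
      ∫ s in (max (t - T) 0)..t, i s := by
  have h1 : Integrable ((Ioo (-T) 0).indicator ι) volume :=
    (integrable_indicator_iff measurableSet_Ioo).2 ((Lp.memLp ι).integrable (by norm_num))
  have h2 : Integrable ((Icc 0 t).indicator i) volume :=
    (integrable_indicator_iff measurableSet_Icc).2
      ((memLp_of_continuous hi t).integrable (by norm_num))
  have h3 : ∀ a b, IntervalIntegrable ((Icc 0 t).indicator i) volume a b :=
    fun a b => h2.intervalIntegrable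
  rw [capital_eq_truncated hT (memLp_of_continuous hi) (R := t) ⟨ht, le_rfl⟩]
  unfold truncatedInvestment
  rw [← intervalIntegral.integral_add_adjacent_intervals
    ((h1.add h2).intervalIntegrable (a := t - T) (b := t)) (IntervalIntegrable.refl (a := t)),
    intervalIntegral.integral_same, add_zero]
  simp only [Pi.add_apply]
  rw [intervalIntegral.integral_add h1.intervalIntegrable (h3 _ _)]
  congr 1
  rw [← intervalIntegral.integral_add_adjacent_intervals (h3 (t - T) (max (t - T) 0)) (h3 _ t)]
  have e1 : ∫ s in (t - T)..(max (t - T) 0), (Icc 0 t).indicator i s = 0 := by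
    rcases le_total (t - T) 0 with h | h
    · rw [max_eq_right h, intervalIntegral.integral_of_le h, integral_Ioc_eq_integral_Ioo]
      refine setIntegral_eq_zero_of_forall_eq_zero fun s hs => ?_
      exact indicator_of_notMem (fun h' => absurd hs.2 (not_lt.2 h'.1)) _
    · rw [max_eq_left h, intervalIntegral.integral_same]
  have hle : max (t - T) 0 ≤ t := max_le (by linarith) ht
  rw [e1, zero_add, intervalIntegral.integral_of_le hle, intervalIntegral.integral_of_le hle]
  refine setIntegral_congr_fun measurableSet_Ioc fun s hs => ?_
  have hs' : s ∈ Icc 0 t := ⟨(le_max_right _ _).trans hs.1.le, hs.2⟩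
  exact indicator_of_mem hs' _

/-- A control realizing a prescribed consumption path of at most exponential growth. -/
theorem exists_control_of_consumption {T A : ℝ} (hT : 0 < T) (hA : 0 < A) (ι : L2Hist T)
    (c₀ γ : ℝ) :
    ∃ i : ℝ → ℝ, Continuous i ∧
      ∀ t, 0 ≤ t → i t = A * capital ι i t - c₀ * Real.exp (γ * t) := by
  have h1 : Integrable ((Ioo (-T) 0).indicator ι) volume :=
    (integrable_indicator_iff measurableSet_Ioo).2 ((Lp.memLp ι).integrable (by norm_num))
  have hwc := continuous_window_integral h1 T
  set N : ℝ := ∫ s, ‖(Ioo (-T) 0).indicator ι s‖ with hN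
  have hN0 : 0 ≤ N := integral_nonneg fun s => norm_nonneg _
  -- The rate `l` exceeds `A`, for the contraction, and `γ`, for the growth of consumption; `M`
  -- bounds the datum through its `L¹` norm `N`.
  obtain ⟨i, hi, hi'⟩ := exists_volterra_delay
    (f := fun t => A * (∫ s in (t - T)..t, (Ioo (-T) 0).indicator ι s) - c₀ * Real.exp (γ * t))
    (by fun_prop) hT.le hA.le (l := A + 1 + |γ|) (M := A * N + |c₀|)
    (by linarith [abs_nonneg γ]) (by
      intro t ht
      have e1 : |∫ s in (t - T)..t, (Ioo (-T) 0).indicator ι s| ≤ N := by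
        rw [intervalIntegral.integral_of_le (by linarith), ← Real.norm_eq_abs]
        exact (norm_integral_le_integral_norm _).trans
          (setIntegral_le_integral h1.norm (Eventually.of_forall fun s => norm_nonneg _))
      have hl : 0 ≤ (A + 1 + |γ|) * t := by positivity
      have e2 : Real.exp (γ * t) ≤ Real.exp ((A + 1 + |γ|) * t) := by
        apply Real.exp_le_exp.2
        exact mul_le_mul_of_nonneg_right (by linarith [le_abs_self γ]) ht
      have e3 := Real.one_le_exp hl
      calc _ ≤ |A * ∫ s in (t - T)..t, (Ioo (-T) 0).indicator ι s| +
            |c₀ * Real.exp (γ * t)| := abs_sub _ _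
        _ = A * |∫ s in (t - T)..t, (Ioo (-T) 0).indicator ι s| + |c₀| * Real.exp (γ * t) := by
            rw [abs_mul, abs_mul, abs_of_pos hA, abs_of_pos (Real.exp_pos _)]
        _ ≤ A * N * Real.exp ((A + 1 + |γ|) * t) + |c₀| * Real.exp ((A + 1 + |γ|) * t) := by
            refine add_le_add ?_ (mul_le_mul_of_nonneg_left e2 (abs_nonneg _))
            calc A * |∫ s in (t - T)..t, (Ioo (-T) 0).indicator ι s| ≤ A * N :=
                  mul_le_mul_of_nonneg_left e1 hA.le
              _ ≤ _ := le_mul_of_one_le_right (by positivity) e3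
        _ = _ := by ring)
  refine ⟨i, hi, fun t ht => ?_⟩
  rw [hi' t ht, capital_eq_add hT ι hi ht]
  ring

/-! ### Sign and budget of the equivalent capital. -/

/-- Bounds for the equivalent capital of a state with nonnegative past investment. -/
theorem Gamma0_bounds {T A ξ : ℝ} (hA : 0 < A) (hξ0 : 0 < ξ)
    (hξ : ξ = A * (1 - Real.exp (-ξ * T))) {x : StateSpace T}
    (hfst : x.fst = -∫ s in Ioo (-T) 0, x.snd s)
    (hsnd : ∀ᵐ s ∂histMeasure T, x.snd s ≤ 0) :
    0 ≤ Gamma0 ξ x ∧ Gamma0 ξ x ≤ ξ / A * x.fst ∧ (0 < x.fst → 0 < Gamma0 ξ x) := by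
  have hi : Integrable x.snd (histMeasure T) := (Lp.memLp x.snd).integrable (by norm_num)
  have hie : Integrable (fun s => Real.exp (ξ * s) * x.snd s) (histMeasure T) := by
    have := (hi.bdd_mul (f := fun s => Real.exp (ξ * s)) (c := 1)
      (Continuous.aestronglyMeasurable (by fun_prop)))
    apply this
    filter_upwards [ae_restrict_mem measurableSet_Ioo] with s hs
    rw [Real.norm_eq_abs, abs_of_pos (Real.exp_pos _)]
    exact Real.exp_le_one_iff.2 (mul_nonpos_of_nonneg_of_nonpos hξ0.le hs.2.le)
  -- By `hfst` the integrand is `(exp (ξ s) - 1) x¹(s)`, a product of two nonpositive factors.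
  have hΓ : Gamma0 ξ x = ∫ s in Ioo (-T) 0, (Real.exp (ξ * s) * x.snd s - x.snd s) := by
    rw [Gamma0, integral_sub hie hi, hfst]
    ring
  have hpos : ∀ s ∈ Ioo (-T) 0, Real.exp (ξ * s) < 1 := fun s hs =>
    (Real.exp_lt_exp.2 (mul_neg_of_pos_of_neg hξ0 hs.2)).trans_eq Real.exp_zero
  have hnn : 0 ≤ᵐ[histMeasure T] fun s => Real.exp (ξ * s) * x.snd s - x.snd s := by
    filter_upwards [hsnd, ae_restrict_mem measurableSet_Ioo] with s h1 h2
    have := hpos s h2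
    simp only [Pi.zero_apply]
    nlinarith
  have h0 : 0 ≤ Gamma0 ξ x := by
    rw [hΓ]
    exact integral_nonneg_of_ae hnn
  refine ⟨h0, ?_, fun hx => lt_of_le_of_ne h0 fun h => ?_⟩
  · have hξA : ξ / A = 1 - Real.exp (-ξ * T) := by
      rw [div_eq_iff hA.ne', mul_comm]
      exact hξ
    rw [hΓ, hfst, hξA, ← integral_neg, ← integral_const_mul]
    refine integral_mono_ae (hie.sub hi) (hi.neg.const_mul _) ?_
    filter_upwards [hsnd, ae_restrict_mem measurableSet_Ioo] with s h1 h2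
    have : Real.exp (-ξ * T) ≤ Real.exp (ξ * s) := Real.exp_le_exp.2 (by nlinarith [h2.1])
    nlinarith
  -- If `Γ₀ = 0`, the nonnegative integrand vanishes a.e., hence so do `x¹` and then `x⁰`.
  · rw [hΓ] at h
    have hz := (integral_eq_zero_iff_of_nonneg_ae hnn (hie.sub hi)).1 h.symm
    have : ∫ s in Ioo (-T) 0, x.snd s = 0 := by
      refine integral_eq_zero_of_ae ?_
      filter_upwards [hz, ae_restrict_mem measurableSet_Ioo] with s h1 h2
      have h3 := hpos s h2
      simp only [Pi.zero_apply] at h1 ⊢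
      have h4 : (Real.exp (ξ * s) - 1) * x.snd s = 0 := by linarith
      exact (mul_eq_zero.1 h4).resolve_left (by linarith)
    rw [hfst, this, neg_zero] at hx
    exact lt_irrefl _ hx

section StatePath

variable {T : ℝ} {ι : L2Hist T} {j : ℝ → ℝ} {y : ℝ → StateSpace T}

theorem IsStatePath.apply_zero (hy : IsStatePath ι j y) :
    y 0 = WithLp.toLp 2 (∫ s in Ioo (-T) 0, ι s, histF T ι) := by
  obtain ⟨h1, h2⟩ := hy 0 le_rfl
  apply WithLp.ofLp_injective 2
  refine Prod.ext ?_ ?_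
  · change (y 0).fst = _
    rw [h1]
    simp [capital]
  · change (y 0).snd = histF T ι
    apply Lp.ext
    refine h2.trans ?_
    filter_upwards [Lp.coeFn_neg (Lp.compMeasurePreserving (fun s : ℝ => -T - s)
      (measurePreserving_reflect T) ι), Lp.coeFn_compMeasurePreserving ι
      (measurePreserving_reflect T), ae_restrict_mem measurableSet_Ioo] with s h3 h4 h5
    rw [histF, h3, Pi.neg_apply, h4, investment, if_pos (by linarith [h5.1]), zero_sub]
    rfl

theorem IsStatePath.fst_eq (hT : 0 < T) (hj : ∀ R : ℝ, MemLp j 2 (volume.restrict (Icc 0 R)))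
    (hy : IsStatePath ι j y) {t : ℝ} (ht : 0 ≤ t) :
    (y t).fst = -∫ s in Ioo (-T) 0, (y t).snd s := by
  obtain ⟨h1, h2⟩ := hy t ht
  have e : ∫ s in Ioo (-T) 0, (y t).snd s =
      ∫ s in Ioo (-T) 0, -truncatedInvestment ι j t (t - T - s) := by
    apply integral_congr_ae
    filter_upwards [h2, ae_restrict_mem measurableSet_Ioo] with s h3 h4
    rw [h3, truncatedInvestment_eq ⟨by linarith [h4.2], by linarith [h4.1]⟩]
  rw [h1, e, integral_neg, neg_neg, setIntegral_Ioo_eq hT,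
    intervalIntegral.integral_comp_sub_left, capital_eq_truncated hT hj (R := t) ⟨ht, le_rfl⟩]
  congr 1 <;> ring

/-- Only times strictly before `t` count: the condition on `j` is empty at `t = 0`, and it is
available at a first time where `j` fails to be positive. -/
theorem IsStatePath.snd_nonpos (hy : IsStatePath ι j y) (hι : ∀ᵐ s ∂histMeasure T, 0 ≤ ι s)
    {t : ℝ} (ht : 0 ≤ t) (hj : ∀ s ∈ Ico 0 t, 0 ≤ j s) :
    ∀ᵐ s ∂histMeasure T, (y t).snd s ≤ 0 := by
  have h1 : ∀ᵐ r ∂(volume : Measure ℝ), r ∈ Ioo (-T) 0 → 0 ≤ ι r :=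
    (ae_restrict_iff' measurableSet_Ioo).1 hι
  have h2 := (Measure.measurePreserving_sub_left volume (t - T)).quasiMeasurePreserving.ae h1
  filter_upwards [(hy t ht).2, ae_restrict_of_ae h2, ae_restrict_mem measurableSet_Ioo]
    with s h3 h4 h5
  rw [h3, neg_nonpos, investment]
  split_ifs with h
  · exact h4 ⟨by linarith [h5.2], h⟩
  · exact hj _ ⟨not_lt.1 h, by linarith [h5.1]⟩

theorem intervalIntegrable_consumption (hj : ∀ R : ℝ, MemLp j 2 (volume.restrict (Icc 0 R)))
    (hy : IsStatePath ι j y) (hyc : ContinuousOn y (Ici 0)) (A : ℝ) {t : ℝ} (ht : 0 ≤ t) :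
    IntervalIntegrable (fun s => A * capital ι j s - j s) volume 0 t := by
  refine IntervalIntegrable.sub (ContinuousOn.intervalIntegrable ?_) ?_
  · rw [uIcc_of_le ht]
    refine continuousOn_const.mul ?_
    refine (continuous_fst.comp_continuousOn (hyc.mono Icc_subset_Ici_self)).congr fun s hs => ?_
    exact (hy s hs.1).1.symm
  · rw [intervalIntegrable_iff_integrableOn_Icc_of_le ht]
    exact (hj t).integrable (by norm_num)

/-- The budget identity for the equivalent capital. -/
theorem IsStatePath.exp_mul_Gamma0 (hT : 0 < T) {A ξ : ℝ} (hA : 0 < A)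
    (hξ : ξ = A * (1 - Real.exp (-ξ * T)))
    (hj : ∀ R : ℝ, MemLp j 2 (volume.restrict (Icc 0 R)))
    (hy : IsStatePath ι j y) (hyc : ContinuousOn y (Ici 0)) {t : ℝ} (ht : 0 ≤ t) :
    Real.exp (-ξ * t) * Gamma0 ξ (y t) = Gamma0 ξ (y 0) -
      ξ / A * ∫ s in (0 : ℝ)..t, Real.exp (-ξ * s) * (A * capital ι j s - j s) := by
  have hc := (intervalIntegrable_consumption hj hy hyc A ht).const_mul (ξ / A)
  have hG : IntervalIntegrable (fun s => Gamma0 ξ (y s)) volume 0 t := by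
    apply ContinuousOn.intervalIntegrable
    rw [uIcc_of_le ht]
    exact (continuous_Gamma0 ξ).comp_continuousOn (hyc.mono Icc_subset_Ici_self)
  rw [exp_neg_mul_eq_of_integral_eq (G₀ := Gamma0 ξ (y 0)) ht hG hc,
    ← intervalIntegral.integral_const_mul]
  · congr 2
    ext s
    ring
  · intro s hs
    rw [Gamma0_eq_inner, Gamma0_eq_inner, hy.inner_eq hT hj hyc _ hs.1]
    congr 1
    apply intervalIntegral.integral_congr
    intro r hr
    rw [uIcc_of_le hs.1] at hr
    simp only
    rw [adjA_add_adjB_exp hA.ne' hξ, (hy r hr.1).1]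

end StatePath

/-! ### Utility maximization under the budget constraint. -/

theorem integrableOn_exp_neg {θ : ℝ} (hθ : 0 < θ) (D : ℝ) :
    IntegrableOn (fun t => D * Real.exp (-θ * t)) (Ioi 0) :=
  (exp_neg_integrableOn_Ioi 0 hθ).const_mul D

theorem lintegral_exp_neg {θ D : ℝ} (hθ : 0 < θ) (hD : 0 ≤ D) :
    ∫⁻ t in Ioi (0 : ℝ), ENNReal.ofReal (D * Real.exp (-θ * t)) = ENNReal.ofReal (D / θ) := by
  rw [← ofReal_integral_eq_lintegral_ofReal (integrableOn_exp_neg hθ D)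
    (Eventually.of_forall fun t => by positivity), integral_const_mul,
    integral_exp_mul_Ioi (by linarith : -θ < 0) 0]
  congr 1
  rw [mul_zero, Real.exp_zero]
  field_simp

theorem integrableOn_and_integral_le_of_bounded {f : ℝ → ℝ} {M : ℝ} (hf0 : ∀ t, 0 ≤ t → 0 ≤ f t)
    (hfi : ∀ t, 0 ≤ t → IntervalIntegrable f volume 0 t)
    (hM : ∀ t, 0 ≤ t → ∫ s in (0 : ℝ)..t, f s ≤ M) :
    IntegrableOn f (Ioi 0) ∧ ∫⁻ t in Ioi (0 : ℝ), ENNReal.ofReal (f t) ≤ ENNReal.ofReal M := by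
  have hi : IntegrableOn f (Ioi 0) := by
    refine integrableOn_Ioi_of_intervalIntegral_norm_bounded (b := fun t : ℝ => t) (l := atTop)
      M 0 (fun t => ?_) tendsto_id ?_
    · rcases le_total 0 t with h | h
      · exact (hfi t h).1
      · simp [Ioc_eq_empty_of_le h]
    · filter_upwards [eventually_ge_atTop 0] with t ht
      refine le_trans (le_of_eq ?_) (hM t ht)
      apply intervalIntegral.integral_congr
      intro s hs
      rw [uIcc_of_le ht] at hs
      exact abs_of_nonneg (hf0 s hs.1)
  refine ⟨hi, ?_⟩
  rw [← ofReal_integral_eq_lintegral_ofReal hi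
    ((ae_restrict_mem measurableSet_Ioi).mono fun t ht => hf0 t (le_of_lt ht))]
  refine ENNReal.ofReal_le_ofReal (le_of_tendsto
    (intervalIntegral_tendsto_integral_Ioi 0 hi tendsto_id) ?_)
  filter_upwards [eventually_ge_atTop 0] with t ht
  exact hM t ht

section Utility

variable {σ ρ ξ θ C : ℝ}

/-- The discounted utility, up to the factor `1 / (1 - σ)`, of a consumption path. -/
noncomputable def discountedPower (ρ σ : ℝ) (c : ℝ → ℝ) : ℝ≥0∞ :=
  ∫⁻ t in Ioi (0 : ℝ), ENNReal.ofReal (Real.exp (-ρ * t)) * ENNReal.ofReal (c t) ^ (1 - σ)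

/-- The first-order condition: discounted marginal utility is proportional to the price `exp (-ξ
t)`. -/
theorem exp_mul_rpow_exp (hC : 0 < C) (hσξ : σ * (ξ - θ) = ξ - ρ) (t : ℝ) :
    Real.exp (-ρ * t) * (C * Real.exp ((ξ - θ) * t)) ^ (-σ) =
      C ^ (-σ) * Real.exp (-ξ * t) := by
  rw [Real.mul_rpow hC.le (Real.exp_pos _).le, ← Real.exp_mul, mul_left_comm, ← Real.exp_add]
  congr 2
  linear_combination (-t) * hσξ

theorem exp_mul_rpow_exp' (hC : 0 < C) (hσξ : σ * (ξ - θ) = ξ - ρ) (t : ℝ) :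
    Real.exp (-ρ * t) * (C * Real.exp ((ξ - θ) * t)) ^ (1 - σ) =
      C ^ (1 - σ) * Real.exp (-θ * t) := by
  rw [Real.mul_rpow hC.le (Real.exp_pos _).le, ← Real.exp_mul, mul_left_comm, ← Real.exp_add]
  congr 2
  linear_combination (-t) * hσξ

theorem discountedPower_exp (hθ : 0 < θ) (hC : 0 < C) (hσξ : σ * (ξ - θ) = ξ - ρ) :
    discountedPower ρ σ (fun t => C * Real.exp ((ξ - θ) * t)) =
      ENNReal.ofReal (C ^ (1 - σ) / θ) := by
  rw [← lintegral_exp_neg hθ (by positivity), discountedPower]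
  congr 1
  ext t
  rw [ENNReal.ofReal_rpow_of_pos (by positivity), ← ENNReal.ofReal_mul (Real.exp_pos _).le,
    exp_mul_rpow_exp' hC hσξ]

theorem lintegral_budget_exp (hθ : 0 < θ) (hC : 0 < C) {κ : ℝ} (hκ : 0 ≤ κ) :
    ∫⁻ t in Ioi (0 : ℝ), ENNReal.ofReal (κ * (Real.exp (-ξ * t) * (C * Real.exp ((ξ - θ) * t)))) =
      ENNReal.ofReal (κ * (C / θ)) := by
  rw [← mul_div_assoc, ← lintegral_exp_neg hθ (by positivity)]
  congr 1
  ext t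
  congr 1
  rw [mul_assoc, mul_left_comm (Real.exp (-ξ * t)), ← Real.exp_add]
  congr 3
  ring

theorem lintegral_budget_le {c : ℝ → ℝ} {κ M : ℝ} (hκ : 0 ≤ κ)
    (hS : ∫⁻ t in Ioi (0 : ℝ), ENNReal.ofReal (Real.exp (-ξ * t) * c t) ≤ ENNReal.ofReal M) :
    ∫⁻ t in Ioi (0 : ℝ), ENNReal.ofReal (κ * (Real.exp (-ξ * t) * c t)) ≤
      ENNReal.ofReal (κ * M) := by
  simp_rw [ENNReal.ofReal_mul hκ]
  rw [lintegral_const_mul' _ _ ENNReal.ofReal_ne_top]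
  gcongr

theorem measurable_discounted (ρ σ C γ : ℝ) :
    Measurable fun t => ENNReal.ofReal (Real.exp (-ρ * t)) *
      ENNReal.ofReal (C * Real.exp (γ * t)) ^ (1 - σ) := by
  fun_prop

theorem discountedPower_le_of_lt_one (hσ0 : 0 < σ) (hσ : σ < 1) (hθ : 0 < θ) (hC : 0 < C)
    (hσξ : σ * (ξ - θ) = ξ - ρ) {c : ℝ → ℝ} (hc : ∀ t, 0 ≤ t → 0 ≤ c t)
    (hS : ∫⁻ t in Ioi (0 : ℝ), ENNReal.ofReal (Real.exp (-ξ * t) * c t) ≤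
      ENNReal.ofReal (C / θ)) :
    discountedPower ρ σ c ≤ discountedPower ρ σ fun t => C * Real.exp ((ξ - θ) * t) := by
  have hκ : 0 ≤ (1 - σ) * C ^ (-σ) := mul_nonneg (by linarith) (by positivity)
  -- The tangent line inequality is integrated without subtraction in `[0, ∞]`: the multiplier times
  -- the budget `C / θ`, a finite number, is added to both sides.
  refine (ENNReal.add_le_add_iff_right
    (ENNReal.ofReal_ne_top (r := (1 - σ) * C ^ (-σ) * (C / θ)))).1 ?_
  refine le_trans ?_ (add_le_add_right (lintegral_budget_le hκ hS) _)
  rw [← lintegral_budget_exp (ξ := ξ) hθ hC hκ, discountedPower, discountedPower,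
    ← lintegral_add_right _ (by fun_prop), ← lintegral_add_left (measurable_discounted _ _ _ _)]
  refine setLIntegral_mono' measurableSet_Ioi fun t ht => ?_
  have hct := hc t (le_of_lt ht)
  have hc₀ : 0 < C * Real.exp ((ξ - θ) * t) := by positivity
  have h1 := rpow_add_le_of_lt_one hσ0 hσ hct hc₀
  have h2 := exp_mul_rpow_exp hC hσξ t
  have h3 := mul_le_mul_of_nonneg_left h1 (Real.exp_pos (-ρ * t)).le
  rw [ENNReal.ofReal_rpow_of_nonneg hct (by linarith), ENNReal.ofReal_rpow_of_pos hc₀,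
    ← ENNReal.ofReal_mul (Real.exp_pos _).le, ← ENNReal.ofReal_mul (Real.exp_pos _).le,
    ← ENNReal.ofReal_add (by positivity) (mul_nonneg hκ (by positivity)),
    ← ENNReal.ofReal_add (by positivity) (mul_nonneg hκ (by positivity))]
  refine ENNReal.ofReal_le_ofReal ?_
  linear_combination h3 + (1 - σ) * (c t - C * Real.exp ((ξ - θ) * t)) * h2

theorem le_discountedPower_of_one_lt (hσ : 1 < σ) (hθ : 0 < θ) (hC : 0 < C)
    (hσξ : σ * (ξ - θ) = ξ - ρ) {c : ℝ → ℝ} (hc : ∀ t, 0 ≤ t → 0 ≤ c t)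
    (hci : IntegrableOn (fun t => Real.exp (-ξ * t) * c t) (Ioi 0))
    (hS : ∫⁻ t in Ioi (0 : ℝ), ENNReal.ofReal (Real.exp (-ξ * t) * c t) ≤
      ENNReal.ofReal (C / θ)) :
    (discountedPower ρ σ fun t => C * Real.exp ((ξ - θ) * t)) ≤ discountedPower ρ σ c := by
  have hκ : 0 ≤ (σ - 1) * C ^ (-σ) := mul_nonneg (by linarith) (by positivity)
  refine (ENNReal.add_le_add_iff_right
    (ENNReal.ofReal_ne_top (r := (σ - 1) * C ^ (-σ) * (C / θ)))).1 ?_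
  refine le_trans ?_ (add_le_add_right (lintegral_budget_le hκ hS) _)
  rw [← lintegral_budget_exp (ξ := ξ) hθ hC hκ, discountedPower, discountedPower,
    ← lintegral_add_right' _ (hci.aestronglyMeasurable.aemeasurable.const_mul _).ennreal_ofReal,
    ← lintegral_add_left (measurable_discounted _ _ _ _)]
  refine setLIntegral_mono' measurableSet_Ioi fun t ht => ?_
  have hc₀ : 0 < C * Real.exp ((ξ - θ) * t) := by positivity
  -- At zero consumption the right integrand is `∞`.
  rcases (hc t (le_of_lt ht)).eq_or_lt with hct | hct
  · rw [← hct, ENNReal.ofReal_zero, ENNReal.zero_rpow_of_neg (by linarith),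
      ENNReal.mul_top (by simp [Real.exp_pos]), top_add]
    exact le_top
  have h1 := rpow_add_le_of_one_lt hσ hct hc₀
  have h2 := exp_mul_rpow_exp hC hσξ t
  have h3 := mul_le_mul_of_nonneg_left h1 (Real.exp_pos (-ρ * t)).le
  rw [ENNReal.ofReal_rpow_of_pos hct, ENNReal.ofReal_rpow_of_pos hc₀,
    ← ENNReal.ofReal_mul (Real.exp_pos _).le, ← ENNReal.ofReal_mul (Real.exp_pos _).le,
    ← ENNReal.ofReal_add (by positivity) (mul_nonneg hκ (by positivity)),
    ← ENNReal.ofReal_add (by positivity) (mul_nonneg hκ (by positivity))]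
  refine ENNReal.ofReal_le_ofReal ?_
  linear_combination h3 + (σ - 1) * (c t - C * Real.exp ((ξ - θ) * t)) * h2

end Utility

theorem welfare_eq_discountedPower {T : ℝ} (A σ ρ : ℝ) (ι : L2Hist T) (i : ℝ → ℝ) :
    welfare A σ ρ ι i = (((1 - σ)⁻¹ : ℝ) : EReal) *
      (discountedPower ρ σ fun t => A * capital ι i t - i t : ℝ≥0∞) := rfl

theorem discountedPower_congr {ρ σ : ℝ} {c d : ℝ → ℝ} (h : ∀ t, 0 ≤ t → c t = d t) :
    discountedPower ρ σ c = discountedPower ρ σ d := by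
  refine setLIntegral_congr_fun measurableSet_Ioi fun t ht => ?_
  simp only [h t (le_of_lt ht)]

theorem capital_congr {T : ℝ} {ι : L2Hist T} {i j : ℝ → ℝ} (h : ∀ t, 0 ≤ t → i t = j t) :
    capital ι i = capital ι j := by
  have : investment ι i = investment ι j := by
    ext s
    unfold investment
    split_ifs with hs
    · rfl
    · exact h s (not_lt.1 hs)
  ext t
  rw [capital, capital, this]

/-- The coefficient of the feedback map. -/
theorem feedback_coeff {A σ ρ ξ : ℝ} (hA : 0 < A) (hξ : 0 < ξ) (hσ : 0 < σ)
    (hθ : 0 < (ρ - ξ * (1 - σ)) / σ) :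
    nu A σ ρ ξ ^ (-1 / σ) * (A / ξ) ^ (1 / σ) = (ρ - ξ * (1 - σ)) / σ * (A / ξ) := by
  have ha : 0 < A / ξ := by positivity
  rw [nu, Real.mul_rpow (by positivity) (by positivity), ← Real.rpow_mul hθ.le,
    ← Real.rpow_mul ha.le, mul_assoc, ← Real.rpow_add ha,
    show -σ * (-1 / σ) = 1 by field_simp,
    show (1 - σ) * (-1 / σ) + 1 / σ = 1 by field_simp; ring, Real.rpow_one, Real.rpow_one]

/-- Puts `v` in the form in which `discountedPower_exp` delivers the welfare of the exponential
path. -/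
theorem candidateV_eq {T A σ ρ ξ : ℝ} (hA : 0 < A) (hξ : 0 < ξ)
    (hθ : 0 < (ρ - ξ * (1 - σ)) / σ) {x : StateSpace T} (hx : 0 < Gamma0 ξ x) :
    candidateV A σ ρ ξ x = (1 - σ)⁻¹ * (((ρ - ξ * (1 - σ)) / σ * (A / ξ) * Gamma0 ξ x) ^ (1 - σ) /
      ((ρ - ξ * (1 - σ)) / σ)) := by
  rw [candidateV, nu]
  generalize (ρ - ξ * (1 - σ)) / σ = θ at *
  have ha : 0 < A / ξ := by positivity
  rw [Real.mul_rpow (by positivity) hx.le, Real.mul_rpow hθ.le ha.le,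
    show (1 : ℝ) - σ = -σ + 1 by ring, Real.rpow_add_one hθ.ne', ← show (1 : ℝ) - σ = -σ + 1 by ring]
  field_simp

/-- For `σ > 1` the factor `(1 - σ)⁻¹` is negative, so welfare is maximized by minimizing the power
integral. -/
theorem welfare_le_of_discountedPower {T A σ ρ : ℝ} {ι : L2Hist T} {i j : ℝ → ℝ} (hσ1 : σ ≠ 1)
    (h1 : σ < 1 → (discountedPower ρ σ fun t => A * capital ι j t - j t) ≤
      discountedPower ρ σ fun t => A * capital ι i t - i t)
    (h2 : 1 < σ → (discountedPower ρ σ fun t => A * capital ι i t - i t) ≤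
      discountedPower ρ σ fun t => A * capital ι j t - j t) :
    welfare A σ ρ ι j ≤ welfare A σ ρ ι i := by
  rw [welfare_eq_discountedPower, welfare_eq_discountedPower]
  rcases lt_or_gt_of_ne hσ1 with h | h
  · refine mul_le_mul_of_nonneg_left (EReal.coe_ennreal_le_coe_ennreal_iff.2 (h1 h)) ?_
    exact EReal.coe_nonneg.2 (inv_nonneg.2 (by linarith))
  · rw [show (1 - σ)⁻¹ = -(σ - 1)⁻¹ by rw [← inv_neg]; ring_nf, EReal.coe_neg, EReal.neg_mul,
      EReal.neg_mul, EReal.neg_le_neg_iff]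
    refine mul_le_mul_of_nonneg_left (EReal.coe_ennreal_le_coe_ennreal_iff.2 (h2 h)) ?_
    exact EReal.coe_nonneg.2 (inv_nonneg.2 (by linarith))

/-! ### Admissible budgets and the optimal path. -/

section Optimality

variable {T A σ ρ ξ : ℝ} {ι : L2Hist T}

/-- The budget constraint satisfied by every admissible consumption path. -/
theorem budget_of_admissible (hT : 0 < T) (hA : 0 < A) (hξ0 : 0 < ξ)
    (hξ : ξ = A * (1 - Real.exp (-ξ * T))) (hι : ∀ᵐ s ∂histMeasure T, 0 ≤ ι s) {j : ℝ → ℝ}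
    (hj : j ∈ admissible A ι) :
    IntegrableOn (fun t => Real.exp (-ξ * t) * (A * capital ι j t - j t)) (Ioi 0) ∧
    ∫⁻ t in Ioi (0 : ℝ), ENNReal.ofReal (Real.exp (-ξ * t) * (A * capital ι j t - j t)) ≤
      ENNReal.ofReal (A / ξ *
        Gamma0 ξ (WithLp.toLp 2 (∫ s in Ioo (-T) 0, ι s, histF T ι) : StateSpace T)) := by
  obtain ⟨hjL, hjA⟩ := hj
  obtain ⟨y, hyc, hy⟩ := exists_isStatePath (ι := ι) hT hjL
  refine integrableOn_and_integral_le_of_bounded (fun t ht => ?_) (fun t ht => ?_) fun t ht => ?_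
  · exact mul_nonneg (Real.exp_pos _).le (sub_nonneg.2 (hjA t ht).2)
  · exact (intervalIntegrable_consumption hjL hy hyc A ht).continuousOn_mul
      (Continuous.continuousOn (by fun_prop))
  · have h1 := hy.exp_mul_Gamma0 hT hA hξ hjL hyc ht
    have h2 := (Gamma0_bounds hA hξ0 hξ (hy.fst_eq hT hjL ht)
      (hy.snd_nonpos hι ht fun s hs => (hjA s hs.1).1)).1
    have h3 := mul_nonneg (Real.exp_pos (-ξ * t)).le h2
    rw [← hy.apply_zero, div_mul_eq_mul_div, le_div_iff₀ hξ0, mul_comm]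
    rw [h1, div_mul_eq_mul_div, sub_nonneg, div_le_iff₀ hA] at h3
    linarith

/-- The state path with exponentially growing equivalent capital. -/
theorem exists_exponential_path (hT : 0 < T) (hA : 0 < A) (hξ0 : 0 < ξ)
    (hξ : ξ = A * (1 - Real.exp (-ξ * T))) {θ : ℝ} (ι : L2Hist T) :
    ∃ (i : ℝ → ℝ) (y : ℝ → StateSpace T), Continuous i ∧ ContinuousOn y (Ici 0) ∧
      IsStatePath ι i y ∧ ∀ t, 0 ≤ t →
        Gamma0 ξ (y t) = Gamma0 ξ (y 0) * Real.exp ((ξ - θ) * t) ∧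
        i t = A * (y t).fst - θ * (A / ξ) * Gamma0 ξ (y t) := by
  obtain ⟨i, hi, hi'⟩ := exists_control_of_consumption hT hA ι (θ * (A / ξ) *
    Gamma0 ξ (WithLp.toLp 2 (∫ s in Ioo (-T) 0, ι s, histF T ι) : StateSpace T)) (ξ - θ)
  obtain ⟨y, hyc, hy⟩ := exists_isStatePath (ι := ι) hT (memLp_of_continuous hi)
  rw [← hy.apply_zero] at hi'
  have hΓ : ∀ t, 0 ≤ t → Gamma0 ξ (y t) = Gamma0 ξ (y 0) * Real.exp ((ξ - θ) * t) := by
    intro t ht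
    -- In the budget identity the spending is `Γ₀(y 0) ∫ θ exp (-θ s)`; keeping `θ` inside the
    -- integral covers `θ = 0` as well.
    have h1 := hy.exp_mul_Gamma0 hT hA hξ (memLp_of_continuous hi) hyc ht
    have h2 : ∫ s in (0 : ℝ)..t, Real.exp (-ξ * s) * (A * capital ι i s - i s) =
        ∫ s in (0 : ℝ)..t, A / ξ * Gamma0 ξ (y 0) * (θ * Real.exp (-θ * s)) := by
      apply intervalIntegral.integral_congr
      intro s hs
      rw [uIcc_of_le ht] at hs
      simp only
      rw [hi' s hs.1, sub_sub_cancel, show -θ * s = -ξ * s + (ξ - θ) * s by ring, Real.exp_add]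
      ring
    have h3 : ∫ s in (0 : ℝ)..t, θ * Real.exp (-θ * s) = 1 - Real.exp (-θ * t) := by
      rw [intervalIntegral.integral_eq_sub_of_hasDerivAt (f := fun s => -Real.exp (-θ * s))]
      · simp
        ring
      · intro s _
        refine (((hasDerivAt_id s).const_mul (-θ)).exp.neg).congr_deriv ?_
        simp only [id]
        ring
      · exact Continuous.intervalIntegrable (by fun_prop) _ _
    rw [h2, intervalIntegral.integral_const_mul, h3] at h1
    have h4 : Real.exp (-ξ * t) * Gamma0 ξ (y t) = Gamma0 ξ (y 0) * Real.exp (-θ * t) := by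
      rw [h1]
      field_simp
      ring
    rw [show -θ * t = -ξ * t + (ξ - θ) * t by ring, Real.exp_add, mul_left_comm] at h4
    exact mul_left_cancel₀ (Real.exp_pos _).ne' h4
  refine ⟨i, y, hi, hyc, hy, fun t ht => ⟨hΓ t ht, ?_⟩⟩
  rw [hi' t ht, (hy t ht).1, hΓ t ht]
  ring

theorem control_pos_of_exponential (hT : 0 < T) (hA : 0 < A) (hξ0 : 0 < ξ)
    (hξ : ξ = A * (1 - Real.exp (-ξ * T))) {θ : ℝ} (hθA : θ < A) (hθ : 0 < θ)
    (hι : ∀ᵐ s ∂histMeasure T, 0 ≤ ι s) {i : ℝ → ℝ} {y : ℝ → StateSpace T} (hi : Continuous i)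
    (hy : IsStatePath ι i y) (hΓ : ∀ t, 0 ≤ t → 0 < Gamma0 ξ (y t))
    (hiy : ∀ t, 0 ≤ t → i t = A * (y t).fst - θ * (A / ξ) * Gamma0 ξ (y t)) {t : ℝ}
    (ht : 0 ≤ t) : 0 < i t := by
  by_contra hneg
  set S : Set ℝ := Ici 0 ∩ i ⁻¹' Iic 0 with hS
  have hSc : IsClosed S := isClosed_Ici.inter (isClosed_Iic.preimage hi)
  have hSb : BddBelow S := ⟨0, fun s hs => hs.1⟩
  -- The first time at which `i ≤ 0`. Investment is nonnegative before it, so `Gamma0_bounds` still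
  -- applies there and gives `i ≥ (A - θ) k > 0`.
  have hm : sInf S ∈ S := hSc.csInf_mem ⟨t, ht, not_lt.1 hneg⟩ hSb
  have hm0 : 0 ≤ sInf S := hm.1
  have hpos : ∀ s ∈ Ico 0 (sInf S), 0 ≤ i s := fun s hs => by
    by_contra h
    exact absurd (csInf_le hSb ⟨hs.1, (not_le.1 h).le⟩) (not_le.2 hs.2)
  have hb := (Gamma0_bounds hA hξ0 hξ (hy.fst_eq hT (memLp_of_continuous hi) hm0)
    (hy.snd_nonpos hι hm0 hpos)).2.1
  have h0 := hΓ _ hm0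
  have hk : 0 < (y (sInf S)).fst := by
    have : 0 < ξ / A := by positivity
    exact pos_of_mul_pos_right (h0.trans_le hb) this.le
  have h1 : θ * (A / ξ) * Gamma0 ξ (y (sInf S)) ≤ θ * (y (sInf S)).fst := by
    calc _ ≤ θ * (A / ξ) * (ξ / A * (y (sInf S)).fst) :=
          mul_le_mul_of_nonneg_left hb (by positivity)
      _ = _ := by field_simp
  have h2 := hiy _ hm0
  have h3 : i (sInf S) ≤ 0 := hm.2
  have h4 : 0 < (A - θ) * (y (sInf S)).fst := mul_pos (by linarith) hk
  linarith

end Optimality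

end VintageCapital

/-! ### The main theorem. -/

theorem mainTheorem9 (T A σ ρ ξ : ℝ) (hT : 0 < T) (hσ : 0 < σ) (hσ1 : σ ≠ 1)
    (hAT : 1 < A * T)
    (hξ : 0 < ξ) (hξ_root : ξ = A * (1 - Real.exp (-ξ * T)))
    (hfin : ξ * (1 - σ) < ρ) (hint : (ρ - ξ * (1 - σ)) / σ < A)
    (k₀ : ℝ) (ι : VintageCapital.L2Hist T) (hk₀ : 0 < k₀)
    (hι : ∀ᵐ s ∂(VintageCapital.histMeasure T), 0 ≤ ι s)
    (hk₀ι : k₀ = ∫ s in Set.Ioo (-T) 0, ι s)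
    (x : VintageCapital.StateSpace T) (hx : x = WithLp.toLp 2 (k₀, VintageCapital.histF T ι)) :
    ∃ y : ℝ → VintageCapital.StateSpace T,
      VintageCapital.IsClosedLoopSolution (VintageCapital.feedback A σ ρ ξ) x y ∧
      (∀ z : ℝ → VintageCapital.StateSpace T,
        VintageCapital.IsClosedLoopSolution (VintageCapital.feedback A σ ρ ξ) x z →
          Set.EqOn z y (Set.Ici 0)) ∧
      (∀ t : ℝ, 0 ≤ t → y t ∈ VintageCapital.setO T A σ ρ ξ ∧ 0 < (y t).fst ∧
        0 < VintageCapital.feedback A σ ρ ξ (y t)) ∧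
      VintageCapital.IsOptimal A σ ρ ι (fun t => VintageCapital.feedback A σ ρ ξ (y t)) ∧
      VintageCapital.value A σ ρ ι =
        ((VintageCapital.candidateV A σ ρ ξ x : ℝ) : EReal) := by
  open VintageCapital in
  have hA : 0 < A := by
    by_contra h
    have := mul_nonpos_of_nonpos_of_nonneg (not_lt.1 h) hT.le
    linarith
  have hθ : 0 < (ρ - ξ * (1 - σ)) / σ := div_pos (by linarith) hσ
  have hcoef := feedback_coeff hA hξ hσ hθ
  have hcand : 0 < Gamma0 ξ x → _ := candidateV_eq (σ := σ) hA hξ hθ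
  have hσξ : σ * (ξ - (ρ - ξ * (1 - σ)) / σ) = ξ - ρ := by field_simp; ring
  have hfb : ∀ z : StateSpace T, feedback A σ ρ ξ z =
      A * z.fst - (ρ - ξ * (1 - σ)) / σ * (A / ξ) * Gamma0 ξ z := fun z => by
    rw [feedback, hcoef]
  have hO : ∀ z : StateSpace T, z ∈ setO T A σ ρ ξ ↔ 0 < Gamma0 ξ z ∧ 0 < feedback A σ ρ ξ z :=
    fun z => by rw [feedback, sub_pos]; rfl
  generalize (ρ - ξ * (1 - σ)) / σ = θ at *
  obtain ⟨i, y, hi, hyc, hy, hyi⟩ := exists_exponential_path (θ := θ) hT hA hξ hξ_root ι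
  have hiL := memLp_of_continuous hi
  have hx0 : y 0 = x := by rw [hy.apply_zero, hx, hk₀ι]
  have hG0 : 0 < Gamma0 ξ x := by
    rw [← hx0]
    refine (Gamma0_bounds hA hξ hξ_root (hy.fst_eq hT hiL le_rfl)
      (hy.snd_nonpos hι le_rfl fun s hs => absurd hs.2 (not_lt.2 hs.1))).2.2 ?_
    rw [hx0, hx]
    exact hk₀
  have hΓ : ∀ t, 0 ≤ t → 0 < Gamma0 ξ (y t) := fun t ht => by
    rw [(hyi t ht).1, hx0]
    positivity
  have hpos : ∀ t, 0 ≤ t → 0 < i t := fun t ht =>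
    control_pos_of_exponential hT hA hξ hξ_root hint hθ hι hi hy hΓ (fun t ht => (hyi t ht).2) ht
  have hfi : ∀ t, 0 ≤ t → feedback A σ ρ ξ (y t) = i t := fun t ht => by
    rw [hfb, (hyi t ht).2]
  have hcap := capital_congr (ι := ι) hfi
  have hC : 0 < θ * (A / ξ) * Gamma0 ξ x := by positivity
  -- The feedback control agrees with `i` only for `t ≥ 0`, which suffices for the capital; its
  -- consumption is the exponential path `c*`.
  have hcons : ∀ t, 0 ≤ t → A * capital ι (fun t => feedback A σ ρ ξ (y t)) t -
      feedback A σ ρ ξ (y t) = θ * (A / ξ) * Gamma0 ξ x * Real.exp ((ξ - θ) * t) := by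
    intro t ht
    rw [hcap, ← (hy t ht).1, hfb, (hyi t ht).1, hx0]
    ring
  have hpow := (discountedPower_congr (ρ := ρ) (σ := σ) hcons)
  have hadm : (fun t => feedback A σ ρ ξ (y t)) ∈ admissible A ι := by
    refine ⟨fun R => (hiL R).ae_eq ?_, fun t ht => ⟨?_, ?_⟩⟩
    · filter_upwards [MeasureTheory.ae_restrict_mem measurableSet_Icc] with t ht
      exact (hfi t ht.1).symm
    · simp only [hfi t ht]
      exact (hpos t ht).le
    · have h1 := hcons t ht
      have h2 : 0 ≤ θ * (A / ξ) * Gamma0 ξ x * Real.exp ((ξ - θ) * t) := by positivity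
      simp only
      linarith
  -- The exponential path spends exactly the budget available to admissible controls.
  have hCθ : θ * (A / ξ) * Gamma0 ξ x / θ = A / ξ * Gamma0 ξ x := by field_simp
  have hopt : IsOptimal A σ ρ ι fun t => feedback A σ ρ ξ (y t) := by
    refine ⟨hadm, fun j hj => welfare_le_of_discountedPower hσ1 (fun h => ?_) fun h => ?_⟩
    all_goals
      obtain ⟨hint', hS⟩ := budget_of_admissible hT hA hξ hξ_root hι hj
      rw [← hk₀ι, ← hx, ← hCθ] at hS
      have hc : ∀ t, 0 ≤ t → 0 ≤ A * capital ι j t - j t := fun t ht => sub_nonneg.2 (hj.2 t ht).2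
      rw [hpow]
    · exact discountedPower_le_of_lt_one hσ h hθ hC hσξ hc hS
    · exact le_discountedPower_of_one_lt h hθ hC hσξ hc hint' hS
  have hsol : IsClosedLoopSolution (feedback A σ ρ ξ) x y := by
    refine ⟨hyc, hx0, fun ψ t ht => ?_⟩
    rw [hy.inner_eq hT hiL hyc ψ ht, hx0]
    congr 1
    apply intervalIntegral.integral_congr
    intro s hs
    rw [Set.uIcc_of_le ht] at hs
    simp only [hfi s hs.1]
  refine ⟨y, hsol, fun z hz => hsol.eqOn hA hξ_root hz, fun t ht => ?_, hopt, ?_⟩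
  · have hft : 0 < feedback A σ ρ ξ (y t) := by rw [hfi t ht]; exact hpos t ht
    refine ⟨(hO _).2 ⟨hΓ t ht, hft⟩, ?_, hft⟩
    have h1 := hfb (y t)
    have h2 : 0 < θ * (A / ξ) * Gamma0 ξ (y t) := mul_pos (by positivity) (hΓ t ht)
    exact pos_of_mul_pos_right (by linarith : 0 < A * (y t).fst) hA.le
  · have hv : value A σ ρ ι = welfare A σ ρ ι fun t => feedback A σ ρ ξ (y t) :=
      le_antisymm (iSup₂_le hopt.2) (le_iSup₂ (f := fun i _ => welfare A σ ρ ι i) _ hadm)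
    rw [hv, welfare_eq_discountedPower, hpow, discountedPower_exp hθ hC hσξ, hcand hG0,
      EReal.coe_mul, EReal.coe_ennreal_ofReal, max_eq_left (by positivity)]
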